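/- **Setting.** A slow base Runge–Kutta method $(A,b)$ with $s$ stages has abscissae $c=A\mathbf 1$, $c_1\le\dots\le c_s\le 1$; put $c_{s+1}:=1$ and $\Delta c_i:=c_{i+1}-c_i$ ($1\le i\le s$). An MRI-GARK method over it is given by a matrix of real polynomials $\gamma_{i,j}(\tau)=\sum_{k\ge0}\gamma^k_{i,j}\tau^k$, $\Gamma^k:=[\gamma_{i,j}^k]\in\mathbb R^{s\times s}$, with $\gamma_{i,j}=0$ for $j\ge i+2$ and $\gamma_{i,i+1}\,\Delta c_i=0$, such that, with $\overline\Gamma:=\sum_k\frac1{k+1}\Gamma^k$ and $E$ the strictly lower triangular matrix of ones, $A=E\,\overline\Gamma$ and $b^T=\mathbf 1^T\overline\Gamma$ (so the first row of $A$ is zero and $c_1=0$). One step of size $H$ for $y'=f^{F}(t,y)+f^{S}(t,y)$ from $(t_n,y_n)$ is: $Y_1=y_n$; for $i=1,\dots,s$, with $T_j=t_n+c_jH$, solve exactly $$v(0)=Y_i,\qquad v'(\theta)=\Delta c_i\, f^{F}(T_i+\Delta c_i\theta,v)+\sum_{j}\gamma_{i,j}(\theta/H)\,f^{S}(T_j,Y_j),\quad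 \theta\in[0,H],\qquad Y_{i+1}=v(H);$$ and $y_{n+1}=Y_{s+1}$. A method has order $p$ (meaning at least $p$) if its local error after one step is $O(H^{p+1})$ as $H\to0^+$, for all $C^\infty$ right-hand sides. If the fast systems are discretized by a Runge–Kutta method $(A^{f},b^{f},c^{f}=A^f\mathbf 1)$, one obtains a multirate GARK method with slow part $(A,b)$ and, in block form over the sub-steps $i,j=1,\dots,s$, $$\mathbf A^{ff}_{ij}=\begin{cases}\Delta c_j\mathbf 1b^{fT}& j<i\\ \Delta c_iA^f& j=i\\ 0& j>i\end{cases},\quad \mathbf b^f_i=\Delta c_i b^f,\quad \mathbf A^{fs}_{i}=\mathbf 1A_{i,:}+\sum_k (A^f (c^{f})^{\times k})\,\Gamma^k_{i,:},\quad \mathbf A^{sf}_{l,j}=\begin{cases}\Delta c_jb^{fT}& j<l\\0& j\ge l\end{cases},$$ and $\mathbf c^f=\mathbf A^{ff}\mathbf 1$. The MRI-GARK method is internally consistent if $\mathbf A^{sf}\mathbf 1=A\mathbf 1$ and $\mathbf A^{ff}\mathbf 1=\mathbf A^{fs}\mathbf 1$ for every fast method with $\sum_i b^f_i=1$ (equivalently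 $\Gamma^0\mathbf 1=\Delta c$ and $\Gamma^k\mathbf 1=0$ for $k\ge1$). For rooted trees let $\tau$ be the one-vertex tree, $\mathfrak t_k=[\tau,\dots,\tau]$ ($k$ times) and $\gamma(\cdot)$ the density; put $\zeta_k=1/\gamma([\mathfrak t_k])=\frac1{(k+1)(k+2)}$, $\omega_k=1/\gamma([\tau,\mathfrak t_k])=\frac1{(k+1)(k+3)}$, $\xi_k=1/\gamma([[\mathfrak t_k]])=\frac1{(k+1)(k+2)(k+3)}$. Let $\mathfrak A=A+\sum_k\zeta_k\Gamma^k$ and $$z_i=c_{i+1}^2-c_i^2,\qquad d_i=\Delta c_i\Bigl(1-\sum_{l=1}^i b_l\Bigr),\qquad t_i=\Delta c_i\sum_{j=i+1}^{s}\Delta c_j .$$ Products $\times$ and powers of vectors are componentwise. **Theorem (fourth order coupling conditions).** Let an MRI-GARK method, with exact fast process, be internally consistent. 1. It has order four if and only if the slow base method $(A,b)$ has order at least four and - (a) $\frac12 z^TAc+\sum_{k\ge0}\bigl(\Delta c\times(\zeta_kc+\omega_k\Delta c)\bigr)^T\Gamma^kc=\frac18$, - (c) $\Delta c^T\mathfrak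 A\,c^{\times2}=\frac1{12}$, - (f) $d^T\mathfrak A\,c=\frac1{24}$, - (h) $(\Delta c^{\times2})^T\bigl(\frac12A+\sum_{k\ge0}\xi_k\Gamma^k\bigr)c+t^T\mathfrak A\,c=\frac1{24}$, - (i) $\Delta c^T\mathfrak A\,A\,c=\frac1{24}$. 2. Let $K$ be the maximal degree of the $\gamma_{i,j}$. If the slow base method has order at least four, then for every fast Runge–Kutta method of order at least $K+3$ the remaining MR-GARK coupling conditions (b) $b^T(c\times\mathbf A^{sf}\mathbf c^f)=\frac18$, (d) $b^T\mathbf A^{sf}(\mathbf c^{f})^{\times2}=\frac1{12}$, (e) $b^TA\mathbf A^{sf}\mathbf c^f=\frac1{24}$, (g) $b^T\mathbf A^{sf}\mathbf A^{ff}\mathbf c^f=\frac1{24}$ hold, and the condition (j) $\mathbf b^{fT}\mathbf A^{fs}\mathbf A^{sf}\mathbf c^f=\frac1{24}$ is equivalent to (c). -/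

import Mathlib

open Matrix Topology

noncomputable section

/-- Rooted trees: `node [u₁, …, uₘ]` is `[u₁, …, uₘ]` in Butcher's notation, and `node []` is the tree `τ` with one vertex. -/
inductive ButcherTree : Type
  | node (children : List ButcherTree) : ButcherTree

namespace ButcherTree

/-- The number of vertices of a rooted tree. -/
def order : ButcherTree → ℕ
  | node l => 1 + (l.map order).sum

/-- The density `γ(u)` of a rooted tree: `γ([u₁, …, uₘ]) = |[u₁, …, uₘ]| γ(u₁) ⋯ γ(uₘ)`. -/
def density : ButcherTree → ℕ
  | node l => order (node l) * (l.map density).prod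

/-- The tree `τ`. -/
def tau : ButcherTree := node []

/-- The bushy tree `𝔱ₖ = [τ, …, τ]` with `k` leaves above the root. -/
def bush (k : ℕ) : ButcherTree := node (List.replicate k tau)

end ButcherTree

open ButcherTree in
/-- `ζₖ = 1 / γ([𝔱ₖ])`. -/
def zetaCoeff (k : ℕ) : ℝ := 1 / (density (node [bush k]) : ℝ)

open ButcherTree in
/-- `ωₖ = 1 / γ([τ, 𝔱ₖ])`. -/
def omegaCoeff (k : ℕ) : ℝ := 1 / (density (node [tau, bush k]) : ℝ)

open ButcherTree in
/-- `ξₖ = 1 / γ([[𝔱ₖ]])`. -/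
def xiCoeff (k : ℕ) : ℝ := 1 / (density (node [node [bush k]]) : ℝ)

theorem ButcherTree.order_bush (k : ℕ) : (bush k).order = k + 1 := by
  simp [bush, tau, order, add_comm]

theorem ButcherTree.density_bush (k : ℕ) : (bush k).density = k + 1 := by
  have h := order_bush k
  simp only [bush] at h ⊢
  rw [density, h]
  simp [tau, order, density]

theorem zetaCoeff_eq (k : ℕ) : zetaCoeff k = 1 / (((k : ℝ) + 1) * (k + 2)) := by
  have h1 := ButcherTree.order_bush k
  have h2 := ButcherTree.density_bush k
  simp only [zetaCoeff, ButcherTree.density, ButcherTree.order, List.map_cons, List.map_nil,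
    List.sum_cons, List.sum_nil, List.prod_cons, List.prod_nil, h1, h2]
  push_cast
  congr 1
  ring

theorem omegaCoeff_eq (k : ℕ) : omegaCoeff k = 1 / (((k : ℝ) + 1) * (k + 3)) := by
  have h1 := ButcherTree.order_bush k
  have h2 := ButcherTree.density_bush k
  simp only [omegaCoeff, ButcherTree.tau, ButcherTree.density, ButcherTree.order, List.map_cons,
    List.map_nil, List.sum_cons, List.sum_nil, List.prod_cons, List.prod_nil, h1, h2]
  push_cast
  congr 1
  ring

theorem xiCoeff_eq (k : ℕ) : xiCoeff k = 1 / (((k : ℝ) + 1) * (k + 2) * (k + 3)) := by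
  have h1 := ButcherTree.order_bush k
  have h2 := ButcherTree.density_bush k
  simp only [xiCoeff, ButcherTree.density, ButcherTree.order, List.map_cons, List.map_nil,
    List.sum_cons, List.sum_nil, List.prod_cons, List.prod_nil, h1, h2]
  push_cast
  congr 1
  ring

/-- An `s`-stage Runge–Kutta method; the abscissae are `c = A 𝟙`. -/
structure RungeKutta (s : ℕ) where
  /-- the coefficient matrix -/
  A : Matrix (Fin s) (Fin s) ℝ
  /-- the weights -/
  b : Fin s → ℝ

namespace RungeKutta

variable {s : ℕ} (R : RungeKutta s)

/-- The abscissae `c = A 𝟙`. -/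
def c : Fin s → ℝ := R.A *ᵥ 1

/-- `Y` are stage values, and `y₁` is the result, of one step of size `H` of the method for
`y' = f(t, y)` from `(t₀, y₀)`. -/
def IsStep {E : Type} [NormedAddCommGroup E] [NormedSpace ℝ E] (f : ℝ → E → E)
    (t₀ : ℝ) (y₀ : E) (H : ℝ) (Y : Fin s → E) (y₁ : E) : Prop :=
  (∀ i, Y i = y₀ + H • ∑ j, R.A i j • f (t₀ + R.c j * H) (Y j)) ∧
    y₁ = y₀ + H • ∑ j, R.b j • f (t₀ + R.c j * H) (Y j)

/-- Order (at least) `p`: for every smooth finite dimensional system and every local solution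
`y` of it, the local error after one step is `O(H ^ (p + 1))` as `H → 0`, `H > 0`. As usual for
implicit methods, the step in question is the one whose stages are near the initial value (for
small `H` the stage equations of a smooth system have exactly one such solution). -/
def HasOrder (p : ℕ) : Prop :=
  ∀ (E : Type) [NormedAddCommGroup E] [NormedSpace ℝ E] [FiniteDimensional ℝ E]
    (f : ℝ → E → E), ContDiff ℝ (⊤ : ℕ∞) (Function.uncurry f) →
    ∀ (t₀ : ℝ) (y : ℝ → E), (∀ᶠ t in 𝓝 t₀, HasDerivAt y (f t (y t)) t) →
    ∃ C > 0, ∃ δ > 0, ∃ H₀ > 0, ∀ H : ℝ, 0 < H → H ≤ H₀ →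
      ∀ (Y : Fin s → E) (y₁ : E), R.IsStep f t₀ (y t₀) H Y y₁ → (∀ i, ‖Y i - y t₀‖ ≤ δ) →
        ‖y₁ - y (t₀ + H)‖ ≤ C * H ^ (p + 1)

/-- The next abscissa `cᵢ₊₁`, where `cₛ₊₁ = 1`. -/
def cNext (i : Fin s) : ℝ := if h : (i : ℕ) + 1 < s then R.c ⟨i + 1, h⟩ else 1

/-- The increments `Δcᵢ = cᵢ₊₁ - cᵢ` of the abscissae, where `cₛ₊₁ = 1`. -/
def Δc (i : Fin s) : ℝ := R.cNext i - R.c i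

end RungeKutta

/-- The largest degree of the entries of a matrix of polynomials. -/
def maxDegree {s : ℕ} (γ : Matrix (Fin s) (Fin s) (Polynomial ℝ)) : ℕ :=
  Finset.univ.sup fun i => Finset.univ.sup fun j => (γ i j).natDegree

/-- The coefficient matrix `Γᵏ` in `Γ(τ) = ∑ₖ Γᵏ τᵏ`. -/
def gammaCoeff {s : ℕ} (γ : Matrix (Fin s) (Fin s) (Polynomial ℝ)) (k : ℕ) :
    Matrix (Fin s) (Fin s) ℝ :=
  γ.map fun q => q.coeff k

/-- The sum `∑ₖ wₖ Γᵏ` (all `Γᵏ` beyond the maximal degree vanish). -/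
def gammaSum {s : ℕ} (γ : Matrix (Fin s) (Fin s) (Polynomial ℝ)) (w : ℕ → ℝ) :
    Matrix (Fin s) (Fin s) ℝ :=
  ∑ k ∈ Finset.range (maxDegree γ + 1), w k • gammaCoeff γ k

/-- An MRI-GARK method: a slow base Runge–Kutta method with nondecreasing abscissae `≤ 1`, and
slow tendency polynomials `γᵢⱼ(τ)`, whose integrated coefficients `Γ̄ = ∑ₖ Γᵏ / (k + 1)` are the
increments between consecutive stages of the base method. -/
structure MRIGARK (s : ℕ) where
  /-- the slow base method -/
  base : RungeKutta s
  /-- the slow tendency coefficients -/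
  γ : Matrix (Fin s) (Fin s) (Polynomial ℝ)
  c_mono : Monotone base.c
  c_le_one : ∀ i, base.c i ≤ 1
  γ_upper : ∀ i j : Fin s, (i : ℕ) + 2 ≤ j → γ i j = 0
  γ_super : ∀ i j : Fin s, (j : ℕ) = i + 1 → base.Δc i ≠ 0 → γ i j = 0
  /-- `A = E Γ̄` with `E` the strictly lower triangular matrix of ones -/
  A_eq : base.A = (Matrix.of fun i j : Fin s => if j < i then (1 : ℝ) else 0) *
    gammaSum γ fun k => 1 / ((k : ℝ) + 1)
  /-- `bᵀ = 𝟙ᵀ Γ̄` -/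
  b_eq : base.b = (1 : Fin s → ℝ) ᵥ* gammaSum γ fun k => 1 / ((k : ℝ) + 1)

namespace MRIGARK

variable {s : ℕ} (M : MRIGARK s)

/-- One step of size `H` of the MRI-GARK method, with the modified fast systems solved exactly,
for `y' = fF(t, y) + fS(t, y)` from `(t₀, y₀)`. `Y 0, …, Y s` are the slow stages (`Y s` is the
new solution), and `v i` on `[0, H]` is the solution of the modified fast system that leads from
`Y i` to `Y (i + 1)`. -/
def IsStep {E : Type} [NormedAddCommGroup E] [NormedSpace ℝ E] (fF fS : ℝ → E → E)
    (t₀ : ℝ) (y₀ : E) (H : ℝ) (Y : Fin (s + 1) → E) (v : Fin s → ℝ → E) : Prop :=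
  Y 0 = y₀ ∧ ∀ i : Fin s,
    v i 0 = Y i.castSucc ∧
    (∀ θ ∈ Set.Icc 0 H, HasDerivWithinAt (v i)
      (M.base.Δc i • fF (t₀ + M.base.c i * H + M.base.Δc i * θ) (v i θ) +
        ∑ j, (M.γ i j).eval (θ / H) • fS (t₀ + M.base.c j * H) (Y j.castSucc))
      (Set.Icc 0 H) θ) ∧
    Y i.succ = v i H

/-- Order (at least) `p` of the MRI-GARK method: for every smooth finite dimensional additively
partitioned system and every local solution `y` of it, the local error after one step is
`O(H ^ (p + 1))` as `H → 0`, `H > 0`; the step is the one that stays near the initial value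
(which exists and is unique for small `H`). -/
def HasOrder (p : ℕ) : Prop :=
  ∀ (E : Type) [NormedAddCommGroup E] [NormedSpace ℝ E] [FiniteDimensional ℝ E]
    (fF fS : ℝ → E → E), ContDiff ℝ (⊤ : ℕ∞) (Function.uncurry fF) →
    ContDiff ℝ (⊤ : ℕ∞) (Function.uncurry fS) →
    ∀ (t₀ : ℝ) (y : ℝ → E), (∀ᶠ t in 𝓝 t₀, HasDerivAt y (fF t (y t) + fS t (y t)) t) →
    ∃ C > 0, ∃ δ > 0, ∃ H₀ > 0, ∀ H : ℝ, 0 < H → H ≤ H₀ →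
      ∀ (Y : Fin (s + 1) → E) (v : Fin s → ℝ → E), M.IsStep fF fS t₀ (y t₀) H Y v →
        (∀ i, ∀ θ ∈ Set.Icc 0 H, ‖v i θ - y t₀‖ ≤ δ) →
        ‖Y (Fin.last s) - y (t₀ + H)‖ ≤ C * H ^ (p + 1)

/-! The multirate GARK tableau that results when the fast process is discretized by a
Runge–Kutta method `F`. A fast stage is indexed by a sub-step and a stage of `F`. -/

section Tableau

variable {σ : ℕ} (F : RungeKutta σ)

/-- `𝐀^{f,f}` -/
def Aff : Matrix (Fin s × Fin σ) (Fin s × Fin σ) ℝ :=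
  Matrix.of fun p q =>
    if q.1 < p.1 then M.base.Δc q.1 * F.b q.2
    else if q.1 = p.1 then M.base.Δc p.1 * F.A p.2 q.2 else 0

/-- `𝐀^{f,s}`: the entry in row `(i, k)`, column `j` is `aᵢⱼ + ∑ₗ a^{f}ₖₗ γᵢⱼ(c^{f}ₗ)`. -/
def Afs : Matrix (Fin s × Fin σ) (Fin s) ℝ :=
  Matrix.of fun p j => M.base.A p.1 j + ∑ l, F.A p.2 l * (M.γ p.1 j).eval (F.c l)

/-- `𝐀^{s,f}` -/
def Asf : Matrix (Fin s) (Fin s × Fin σ) ℝ :=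
  Matrix.of fun i q => if q.1 < i then M.base.Δc q.1 * F.b q.2 else 0

/-- `𝐛^{f} = Δc ⊗ b^{f}` -/
def bf : Fin s × Fin σ → ℝ := fun p => M.base.Δc p.1 * F.b p.2

/-- `𝐜^{f} = 𝐀^{f,f} 𝟙` -/
def cf : Fin s × Fin σ → ℝ := M.Aff F *ᵥ 1

end Tableau

/-- Internal consistency: `𝐜^{s,f} = 𝐜^{s,s}` and `𝐜^{f,f} = 𝐜^{f,s}` for every (consistent) fast
Runge–Kutta method. -/
def InternallyConsistent : Prop :=
  ∀ (σ : ℕ) (F : RungeKutta σ), ∑ i, F.b i = 1 →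
    M.Asf F *ᵥ 1 = M.base.A *ᵥ 1 ∧ M.Aff F *ᵥ 1 = M.Afs F *ᵥ 1

/-- `𝔄 = A + ∑ₖ ζₖ Γᵏ` -/
def frakA : Matrix (Fin s) (Fin s) ℝ := M.base.A + gammaSum M.γ zetaCoeff

/-- `zᵢ = cᵢ₊₁² - cᵢ²` -/
def z (i : Fin s) : ℝ := M.base.cNext i ^ 2 - M.base.c i ^ 2

/-- `dᵢ = Δcᵢ (1 - ∑_{l ≤ i} bₗ)` -/
def d (i : Fin s) : ℝ := M.base.Δc i * (1 - ∑ l ∈ Finset.Iic i, M.base.b l)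

/-- `tᵢ = Δcᵢ ∑_{j > i} Δcⱼ` -/
def t (i : Fin s) : ℝ := M.base.Δc i * ∑ j ∈ Finset.Ioi i, M.base.Δc j

end MRIGARK

end

/-!
With an exact fast process, the error of an MRI-GARK step satisfies a differential equation on the
sub-steps, and to the order needed that equation is solved by polynomials.

Parametrize each sub-step by `x ∈ [0, 1]`, so that time is `cᵢ + Δcᵢ x` in units of `H`
(`timePoly`). Two integration operators describe the response of the method: `slowOp σ` to slow
stage values `σ`, with derivative `∑ⱼ γᵢⱼ(x) σⱼ`, and `fastOp g` to a fast function `g`, with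
derivative `Δcᵢ gᵢ(x)`. Their final values are `b ⬝ σ` and `fastEnd g`, and every coupling condition
is a final value of a composition of them; for instance, with `g = slowOp c`, the first one says
`∫ t g = 1 / 8` and the fourth `∫∫ g = 1 / 24`. Adding these two (integration by parts) gives the
coupling condition of order three, `∫ g = 1 / 6`, which therefore need not be listed.

Necessity: on the triangular systems `y₁' = tᵐ`, `y₂' = tⁿ y₁`, `y₃' = y₂`, with each right-hand
side put into the slow or the fast part, a step is polynomial, and the error of each component is a
power of `H` times the defect of one condition (`MRIGARK.HasOrder.conditions`, and
`RungeKutta.HasOrder.conditions` for Runge–Kutta methods). The base method inherits the order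
because it is the MRI-GARK method for `f^F = 0` (`MRIGARK.HasOrder.base`).

Sufficiency: let `ε` be the difference between the modified fast solution and the exact one at the
same time. By internal consistency `ε = O(H ^ 2)`, so up to `O(H ^ 5)` it satisfies a linear
equation, in which only the values and first derivatives of the two Jacobians along the solution
and the Taylor coefficients of the slow tendency `f^S(t, y(t))` occur. The solution of that linear
equation up to `H ^ 4` has thirteen terms, each a scalar profile times a vector
(`MRIGARK.ErrorTermsVanish`), and the order conditions say that all of them vanish at the end of
the step (`MRIGARK.errorTermsVanish`, `MRIGARK.ErrorTermsVanish.exists_norm_last_le`,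
`MRIGARK.ErrorTermsVanish.hasOrder`). Both `ε = O(H ^ 2)` and the final estimate are obtained by
absorption: integrating over a step gains a factor `H`, so a bound `B` improves to `B / 2` plus the
expected power of `H`. This treats implicit slow stages like explicit ones.

For a discretized fast process the conditions reduce to those of the base method, and the last one
to the condition `∫ slowOp c² = 1 / 12`, because a fast method of the given order integrates the
polynomials that occur exactly
(`MRIGARK.discretized_coupling`).
-/

/-! ### Antiderivatives of polynomials -/

section Antiderivative

open Polynomial

/-- The antiderivative `∫₀ˣ p` of a real polynomial, again as a polynomial. -/
noncomputable def antideriv : ℝ[X] →ₗ[ℝ] ℝ[X] :=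
  Polynomial.lsum fun k => (1 / ((k : ℝ) + 1)) • monomial (k + 1)

/-- The integral `∫₀¹ p` of a real polynomial. -/
noncomputable def unitIntegral : ℝ[X] →ₗ[ℝ] ℝ :=
  (Polynomial.leval 1).comp antideriv

theorem antideriv_monomial (k : ℕ) (a : ℝ) :
    antideriv (monomial k a) = monomial (k + 1) (a / (k + 1)) := by
  simp only [antideriv, lsum_apply]
  rw [sum_monomial_index]
  · simp [smul_monomial, div_eq_inv_mul]
  · simp

theorem derivative_antideriv (p : ℝ[X]) : derivative (antideriv p) = p := by
  induction p using Polynomial.induction_on' with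
  | add p q hp hq => simp [hp, hq]
  | monomial k a =>
    rw [antideriv_monomial, derivative_monomial]
    have : (k : ℝ) + 1 ≠ 0 := by positivity
    simp [this]

@[simp]
theorem eval_zero_antideriv (p : ℝ[X]) : (antideriv p).eval 0 = 0 := by
  induction p using Polynomial.induction_on' with
  | add p q hp hq => simp [hp, hq]
  | monomial k a => simp [antideriv_monomial]

theorem unitIntegral_apply (p : ℝ[X]) : unitIntegral p = (antideriv p).eval 1 := rfl

theorem unitIntegral_monomial (k : ℕ) (a : ℝ) : unitIntegral (monomial k a) = a / (k + 1) := by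
  simp [unitIntegral_apply, antideriv_monomial]

theorem unitIntegral_C (a : ℝ) : unitIntegral (C a) = a := by
  rw [← monomial_zero_left, unitIntegral_monomial]; simp

theorem unitIntegral_C_mul (a : ℝ) (p : ℝ[X]) :
    unitIntegral (C a * p) = a * unitIntegral p := by
  rw [← smul_eq_C_mul, map_smul, smul_eq_mul]

/-- The fundamental theorem of calculus for polynomials. -/
theorem antideriv_derivative (q : ℝ[X]) : antideriv (derivative q) = q - C (q.eval 0) := by
  have h : derivative (antideriv (derivative q) - q) = 0 := by simp [derivative_antideriv]
  have h' := eq_C_of_derivative_eq_zero h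
  have h0 : (antideriv (derivative q) - q).coeff 0 = - q.eval 0 := by
    rw [coeff_zero_eq_eval_zero]; simp
  rw [h0] at h'
  rw [sub_eq_iff_eq_add.1 h']
  simp [add_comm, sub_eq_add_neg]

/-- A linear functional on polynomials, evaluated at the tendency polynomials, is a weighted sum
of the coefficient matrices. -/
theorem gammaSum_apply_eq {s : ℕ} (γ : Matrix (Fin s) (Fin s) ℝ[X]) (L : ℝ[X] →ₗ[ℝ] ℝ)
    {w : ℕ → ℝ} (hL : ∀ k ≤ maxDegree γ, ∀ a, L (monomial k a) = w k * a) (i j : Fin s) :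
    gammaSum γ w i j = L (γ i j) := by
  have hd : (γ i j).natDegree < maxDegree γ + 1 :=
    Nat.lt_succ_of_le ((Finset.le_sup (f := fun j => (γ i j).natDegree) (Finset.mem_univ j)).trans
      (Finset.le_sup (f := fun i => Finset.univ.sup fun j => (γ i j).natDegree)
        (Finset.mem_univ i)))
  conv_rhs => rw [as_sum_range' (γ i j) _ hd]
  simp only [gammaSum, gammaCoeff, Matrix.sum_apply, Matrix.smul_apply, Matrix.map_apply,
    smul_eq_mul, map_sum]
  exact Finset.sum_congr rfl fun k hk => (hL k (Nat.lt_succ_iff.1 (Finset.mem_range.1 hk)) _).symm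

theorem gammaSum_unitIntegral {s : ℕ} (γ : Matrix (Fin s) (Fin s) ℝ[X]) (i j : Fin s) :
    gammaSum γ (fun k => 1 / ((k : ℝ) + 1)) i j = unitIntegral (γ i j) :=
  gammaSum_apply_eq γ _ (fun k _ a => by rw [unitIntegral_monomial]; ring) i j

theorem gammaSum_zetaCoeff {s : ℕ} (γ : Matrix (Fin s) (Fin s) ℝ[X]) (i j : Fin s) :
    gammaSum γ zetaCoeff i j = unitIntegral (antideriv (γ i j)) := by
  refine gammaSum_apply_eq γ (unitIntegral ∘ₗ antideriv) (fun k _ a => ?_) i j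
  rw [LinearMap.comp_apply, antideriv_monomial, unitIntegral_monomial, zetaCoeff_eq]
  push_cast
  field_simp
  ring

theorem gammaSum_omegaCoeff {s : ℕ} (γ : Matrix (Fin s) (Fin s) ℝ[X]) (i j : Fin s) :
    gammaSum γ omegaCoeff i j = unitIntegral (X * antideriv (γ i j)) := by
  refine gammaSum_apply_eq γ (unitIntegral ∘ₗ LinearMap.mulLeft ℝ X ∘ₗ antideriv)
    (fun k _ a => ?_) i j
  rw [LinearMap.comp_apply, LinearMap.comp_apply, antideriv_monomial, LinearMap.mulLeft_apply,
    X_mul_monomial, unitIntegral_monomial, omegaCoeff_eq]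
  push_cast
  field_simp
  ring

theorem gammaSum_xiCoeff {s : ℕ} (γ : Matrix (Fin s) (Fin s) ℝ[X]) (i j : Fin s) :
    gammaSum γ xiCoeff i j = unitIntegral (antideriv (antideriv (γ i j))) := by
  refine gammaSum_apply_eq γ (unitIntegral ∘ₗ antideriv ∘ₗ antideriv) (fun k _ a => ?_) i j
  rw [LinearMap.comp_apply, LinearMap.comp_apply, antideriv_monomial, antideriv_monomial,
    unitIntegral_monomial, xiCoeff_eq]
  push_cast
  field_simp
  ring

end Antiderivative

/-! ### Integration across the sub-steps -/

section Chain

open Polynomial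

variable {s : ℕ}

/-- The values at the ends of the sub-steps of the continuous function that vanishes at the
beginning and has derivative `r i` in the `i`-th sub-step, each sub-step being parametrized by
`[0, 1]`. -/
noncomputable def chainNode (r : Fin s → ℝ[X]) (k : Fin (s + 1)) : ℝ :=
  ∑ j : Fin s, if (j : ℕ) < k then unitIntegral (r j) else 0

theorem chainNode_add (r r' : Fin s → ℝ[X]) (k : Fin (s + 1)) :
    chainNode (r + r') k = chainNode r k + chainNode r' k := by
  rw [chainNode, chainNode, chainNode, ← Finset.sum_add_distrib]
  refine Finset.sum_congr rfl fun j _ => ?_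
  split_ifs <;> simp

theorem chainNode_smul (a : ℝ) (r : Fin s → ℝ[X]) (k : Fin (s + 1)) :
    chainNode (a • r) k = a * chainNode r k := by
  rw [chainNode, chainNode, Finset.mul_sum]
  refine Finset.sum_congr rfl fun j _ => ?_
  split_ifs <;> simp

/-- The continuous function that vanishes at the beginning and has derivative `r i` in the `i`-th
sub-step, each sub-step being parametrized by `[0, 1]`. -/
noncomputable def chain : (Fin s → ℝ[X]) →ₗ[ℝ] (Fin s → ℝ[X]) where
  toFun r i := C (chainNode r i.castSucc) + antideriv (r i)
  map_add' r r' := by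
    ext1 i
    rw [chainNode_add]
    simp only [Pi.add_apply, map_add]
    ring
  map_smul' a r := by
    ext1 i
    rw [chainNode_smul]
    simp only [Pi.smul_apply, map_smul, smul_add, RingHom.id_apply, smul_C, smul_eq_mul]

theorem chain_apply (r : Fin s → ℝ[X]) (i : Fin s) :
    chain r i = C (chainNode r i.castSucc) + antideriv (r i) := rfl

theorem derivative_chain (r : Fin s → ℝ[X]) (i : Fin s) : derivative (chain r i) = r i := by
  simp [chain_apply, derivative_antideriv]

theorem chainNode_zero (r : Fin s → ℝ[X]) : chainNode r 0 = 0 := by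
  simp [chainNode]

theorem chainNode_last (r : Fin s → ℝ[X]) :
    chainNode r (Fin.last s) = ∑ i, unitIntegral (r i) := by
  simp [chainNode]

theorem chainNode_castSucc (r : Fin s → ℝ[X]) (i : Fin s) :
    chainNode r i.castSucc = ∑ j, if j < i then unitIntegral (r j) else 0 := by
  simp [chainNode]

theorem chainNode_succ (r : Fin s → ℝ[X]) (i : Fin s) :
    chainNode r i.succ = chainNode r i.castSucc + unitIntegral (r i) := by
  rw [chainNode, chainNode_castSucc]
  have h : ∀ j : Fin s, (if (j : ℕ) < (i.succ : Fin (s + 1)) then unitIntegral (r j) else 0) =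
      (if j < i then unitIntegral (r j) else 0) + if j = i then unitIntegral (r j) else 0 := by
    intro j
    rcases lt_trichotomy j i with h | h | h
    · have : (j : ℕ) < i + 1 := by have : (j : ℕ) < i := h; omega
      simp [h, h.ne, this]
    · simp [h]
    · have : ¬ (j : ℕ) < i + 1 := by have : (i : ℕ) < j := h; omega
      simp [h.not_gt, h.ne', this]
  rw [Finset.sum_congr rfl fun j _ => h j, Finset.sum_add_distrib]
  simp

theorem eval_zero_chain (r : Fin s → ℝ[X]) (i : Fin s) :
    (chain r i).eval 0 = chainNode r i.castSucc := by
  simp [chain_apply]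

theorem eval_one_chain (r : Fin s → ℝ[X]) (i : Fin s) :
    (chain r i).eval 1 = chainNode r i.succ := by
  simp [chain_apply, chainNode_succ, unitIntegral_apply]

/-- A function on the sub-steps that is continuous across them is determined by its derivative. -/
theorem chain_eq_of_derivative {r q : Fin s → ℝ[X]} {Q : Fin (s + 1) → ℝ} (hQ : Q 0 = 0)
    (h0 : ∀ i, (q i).eval 0 = Q i.castSucc) (h1 : ∀ i, (q i).eval 1 = Q i.succ)
    (hd : ∀ i, derivative (q i) = r i) : chainNode r = Q ∧ chain r = q := by
  have hn : chainNode r = Q := by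
    ext k
    induction k using Fin.induction with
    | zero => rw [chainNode_zero, hQ]
    | succ i ih =>
      rw [chainNode_succ, ih, ← hd i, unitIntegral_apply, antideriv_derivative, ← h1, ← h0]
      simp
  refine ⟨hn, ?_⟩
  ext1 i
  rw [chain_apply, hn, ← hd i, antideriv_derivative, h0]
  ring

end Chain

/-! ### Slow and fast integration operators of an MRI-GARK method -/

namespace MRIGARK

section Operators

open Polynomial

variable {s : ℕ} (M : MRIGARK s)

/-- The slow tendency `∑ⱼ γᵢⱼ(x) σⱼ` with slow stage values `σ`. -/
noncomputable def slowRhs : (Fin s → ℝ) →ₗ[ℝ] (Fin s → ℝ[X]) where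
  toFun σ i := ∑ j, σ j • M.γ i j
  map_add' σ σ' := by ext1 i; simp [add_smul, Finset.sum_add_distrib]
  map_smul' a σ := by ext1 i; simp [Finset.smul_sum, mul_smul]

/-- The fast tendency `Δcᵢ gᵢ(x)`. -/
noncomputable def fastRhs : (Fin s → ℝ[X]) →ₗ[ℝ] (Fin s → ℝ[X]) where
  toFun g i := M.base.Δc i • g i
  map_add' g g' := by ext1 i; simp
  map_smul' a g := by ext1 i; exact smul_comm (M.base.Δc i) a (g i)

/-- The response of the method to slow stage values `σ`, as a function on the sub-steps. -/
noncomputable def slowOp : (Fin s → ℝ) →ₗ[ℝ] (Fin s → ℝ[X]) := chain ∘ₗ M.slowRhs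

/-- The response of the method to a fast function `g` on the sub-steps. -/
noncomputable def fastOp : (Fin s → ℝ[X]) →ₗ[ℝ] (Fin s → ℝ[X]) := chain ∘ₗ M.fastRhs

/-- The final value of `fastOp g`, which is `∫₀¹ g` over the whole step. -/
noncomputable def fastEnd : (Fin s → ℝ[X]) →ₗ[ℝ] ℝ where
  toFun g := ∑ i, M.base.Δc i * unitIntegral (g i)
  map_add' g g' := by simp [mul_add, Finset.sum_add_distrib]
  map_smul' a g := by
    simp only [Pi.smul_apply, map_smul, smul_eq_mul, Finset.mul_sum, RingHom.id_apply]
    exact Finset.sum_congr rfl fun i _ => by ring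

/-- The values at the beginnings of the sub-steps, that is, at the slow stages. -/
noncomputable def stage : (Fin s → ℝ[X]) →ₗ[ℝ] (Fin s → ℝ) where
  toFun g i := (g i).eval 0
  map_add' g g' := by ext1 i; simp
  map_smul' a g := by ext1 i; simp

/-- Time in the `i`-th sub-step: `cᵢ + Δcᵢ x`. -/
noncomputable def timePoly (i : Fin s) : ℝ[X] := C (M.base.c i) + C (M.base.Δc i) * X

theorem slowRhs_apply (σ : Fin s → ℝ) (i : Fin s) : M.slowRhs σ i = ∑ j, σ j • M.γ i j := rfl

theorem fastRhs_apply (g : Fin s → ℝ[X]) (i : Fin s) : M.fastRhs g i = M.base.Δc i • g i := rfl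

theorem stage_apply (g : Fin s → ℝ[X]) (i : Fin s) : stage g i = (g i).eval 0 := rfl

theorem fastEnd_apply (g : Fin s → ℝ[X]) :
    M.fastEnd g = ∑ i, M.base.Δc i * unitIntegral (g i) := rfl

theorem A_apply (i j : Fin s) :
    M.base.A i j = ∑ k, if k < i then unitIntegral (M.γ k j) else 0 := by
  rw [M.A_eq, Matrix.mul_apply]
  simp only [gammaSum_unitIntegral, Matrix.of_apply, ite_mul, one_mul, zero_mul]

theorem b_apply (j : Fin s) : M.base.b j = ∑ k, unitIntegral (M.γ k j) := by
  rw [M.b_eq, Matrix.vecMul]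
  simp only [dotProduct, gammaSum_unitIntegral, Pi.one_apply, one_mul]

theorem chainNode_slowRhs_castSucc (σ : Fin s → ℝ) (i : Fin s) :
    chainNode (M.slowRhs σ) i.castSucc = (M.base.A *ᵥ σ) i := by
  rw [chainNode_castSucc, mulVec, dotProduct]
  simp only [A_apply, slowRhs_apply, map_sum, map_smul, smul_eq_mul, Finset.sum_mul]
  rw [Finset.sum_comm]
  refine Finset.sum_congr rfl fun k _ => ?_
  split_ifs <;> simp [mul_comm]

theorem chainNode_slowRhs_last (σ : Fin s → ℝ) :
    chainNode (M.slowRhs σ) (Fin.last s) = M.base.b ⬝ᵥ σ := by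
  rw [chainNode_last, dotProduct]
  simp only [b_apply, slowRhs_apply, map_sum, map_smul, smul_eq_mul, Finset.sum_mul]
  rw [Finset.sum_comm]
  simp [mul_comm]

theorem chainNode_fastRhs_last (g : Fin s → ℝ[X]) :
    chainNode (M.fastRhs g) (Fin.last s) = M.fastEnd g := by
  simp [chainNode_last, fastRhs_apply, fastEnd_apply]

theorem stage_slowOp (σ : Fin s → ℝ) : stage (M.slowOp σ) = M.base.A *ᵥ σ := by
  ext i
  rw [stage_apply, slowOp, LinearMap.comp_apply, eval_zero_chain, chainNode_slowRhs_castSucc]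

theorem slowOp_apply (σ : Fin s → ℝ) (i : Fin s) :
    M.slowOp σ i = C ((M.base.A *ᵥ σ) i) + ∑ j, σ j • antideriv (M.γ i j) := by
  rw [slowOp, LinearMap.comp_apply, chain_apply, chainNode_slowRhs_castSucc, slowRhs_apply]
  simp

theorem stage_fastOp (g : Fin s → ℝ[X]) (i : Fin s) :
    stage (M.fastOp g) i = ∑ j, if j < i then M.base.Δc j * unitIntegral (g j) else 0 := by
  rw [stage_apply, fastOp, LinearMap.comp_apply, eval_zero_chain, chainNode_castSucc]
  simp [fastRhs_apply]

theorem unitIntegral_slowOp (σ : Fin s → ℝ) (i : Fin s) :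
    unitIntegral (M.slowOp σ i) = (M.frakA *ᵥ σ) i := by
  rw [slowOp_apply, frakA, add_mulVec, map_add, unitIntegral_C]
  simp [mulVec, dotProduct, gammaSum_zetaCoeff, mul_comm]

/-- The integral over the step of the response to slow stage values is given by `𝔄`. -/
theorem fastEnd_slowOp (σ : Fin s → ℝ) :
    M.fastEnd (M.slowOp σ) = M.base.Δc ⬝ᵥ (M.frakA *ᵥ σ) := by
  simp [fastEnd_apply, unitIntegral_slowOp, dotProduct]

theorem timePoly_eval_zero (i : Fin s) : (M.timePoly i).eval 0 = M.base.c i := by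
  simp [timePoly]

theorem timePoly_eval_one (i : Fin s) : (M.timePoly i).eval 1 = M.base.cNext i := by
  simp [timePoly, RungeKutta.Δc]

/-- The integral of `t g(t)` over the step, where `g` is the response to the slow stage values `σ`;
in each sub-step `t = cᵢ + Δcᵢ x` splits it into the weights `ζₖ` and `ωₖ`. -/
theorem fastEnd_timePoly_mul_slowOp (σ : Fin s → ℝ) :
    M.fastEnd (M.timePoly * M.slowOp σ) = 1 / 2 * (M.z ⬝ᵥ (M.base.A *ᵥ σ)) +
        ∑ k ∈ Finset.range (maxDegree M.γ + 1),
          (M.base.Δc * (zetaCoeff k • M.base.c + omegaCoeff k • M.base.Δc)) ⬝ᵥ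
            (gammaCoeff M.γ k *ᵥ σ) := by
  have h1 : ∀ i, unitIntegral ((M.timePoly * M.slowOp σ) i) =
      (M.base.c i + M.base.Δc i / 2) * (M.base.A *ᵥ σ) i +
      ∑ j, (M.base.c i * gammaSum M.γ zetaCoeff i j +
        M.base.Δc i * gammaSum M.γ omegaCoeff i j) * σ j := by
    intro i
    have e : (M.timePoly * M.slowOp σ) i =
        C (M.base.c i * (M.base.A *ᵥ σ) i) +
        C (M.base.Δc i * (M.base.A *ᵥ σ) i) * X +
        ∑ j, (C (M.base.c i * σ j) * antideriv (M.γ i j) +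
          C (M.base.Δc i * σ j) * (X * antideriv (M.γ i j))) := by
      rw [Pi.mul_apply, slowOp_apply, timePoly, mul_add, Finset.mul_sum]
      simp only [smul_eq_C_mul, C_mul]
      congr 1
      · ring
      · refine Finset.sum_congr rfl fun j _ => ?_
        ring
    have hX : unitIntegral X = 1 / 2 := by
      rw [← monomial_one_one_eq_X, unitIntegral_monomial]; norm_num
    rw [e]
    simp only [map_add, map_sum, unitIntegral_C_mul, unitIntegral_C, gammaSum_zetaCoeff,
      gammaSum_omegaCoeff, hX]
    congr 1
    · ring
    · refine Finset.sum_congr rfl fun j _ => ?_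
      ring
  simp only [fastEnd_apply, h1, mul_add, Finset.sum_add_distrib]
  congr 1
  · rw [dotProduct, Finset.mul_sum]
    refine Finset.sum_congr rfl fun i _ => ?_
    rw [z, RungeKutta.Δc]
    ring
  · simp only [dotProduct]
    rw [Finset.sum_comm]
    refine Finset.sum_congr rfl fun i _ => ?_
    simp only [gammaSum, dotProduct, mulVec, Matrix.sum_apply, Finset.mul_sum, Finset.sum_mul,
      ← Finset.sum_add_distrib, Matrix.smul_apply]
    rw [Finset.sum_comm]
    refine Finset.sum_congr rfl fun k _ => Finset.sum_congr rfl fun j _ => ?_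
    simp only [Pi.mul_apply, Pi.add_apply, Pi.smul_apply, smul_eq_mul]
    ring

/-- The iterated integral `∫₀¹ ∫₀ᵗ g` over the step, where `g` is the response to the slow stage
values `σ`: pairs of distinct sub-steps give the `𝔄` term, the diagonal gives the weights `ξₖ`. -/
theorem fastEnd_fastOp_slowOp (σ : Fin s → ℝ) :
    M.fastEnd (M.fastOp (M.slowOp σ)) =
      (M.base.Δc ^ 2) ⬝ᵥ (((1 / 2 : ℝ) • M.base.A + gammaSum M.γ xiCoeff) *ᵥ σ) +
        M.t ⬝ᵥ (M.frakA *ᵥ σ) := by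
  have h1 : ∀ i, unitIntegral (M.fastOp (M.slowOp σ) i) =
      (∑ j, if j < i then M.base.Δc j * (M.frakA *ᵥ σ) j else 0) +
      M.base.Δc i * ((((1 / 2 : ℝ) • M.base.A + gammaSum M.γ xiCoeff) *ᵥ σ) i) := by
    intro i
    rw [fastOp, LinearMap.comp_apply, chain_apply, map_add, unitIntegral_C, chainNode_castSucc]
    congr 1
    · simp [fastRhs_apply, unitIntegral_slowOp]
    · have hC : ∀ a : ℝ, unitIntegral (antideriv (C a)) = a / 2 := fun a => by
        rw [← monomial_zero_left, antideriv_monomial, unitIntegral_monomial]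
        norm_num
      rw [fastRhs_apply, slowOp_apply, add_mulVec, smul_mulVec]
      simp only [map_add, map_smul, hC, map_sum, smul_eq_mul, Pi.add_apply, Pi.smul_apply]
      simp only [mulVec, dotProduct, gammaSum_xiCoeff]
      congr 2
      · ring
      · exact Finset.sum_congr rfl fun j _ => mul_comm _ _
  simp only [fastEnd_apply, h1, mul_add, Finset.sum_add_distrib]
  rw [add_comm]
  congr 1
  · simp only [dotProduct, Pi.pow_apply]
    exact Finset.sum_congr rfl fun i _ => by ring
  · simp only [dotProduct, t, Finset.mul_sum, Finset.sum_mul]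
    rw [Finset.sum_comm]
    refine Finset.sum_congr rfl fun i _ => ?_
    rw [← Finset.filter_lt_eq_Ioi, Finset.sum_filter]
    refine Finset.sum_congr rfl fun j _ => ?_
    split_ifs <;> ring

/-- The slow response to the fast response to `g`, where `g` is the slow response to `σ`: summation
by parts moves the weights `b` onto the sub-steps. -/
theorem dotProduct_stage_fastOp_slowOp (hb : ∑ i, M.base.b i = 1) (σ : Fin s → ℝ) :
    M.base.b ⬝ᵥ stage (M.fastOp (M.slowOp σ)) = M.d ⬝ᵥ (M.frakA *ᵥ σ) := by
  have h : ∀ i, 1 - ∑ l ∈ Finset.Iic i, M.base.b l = ∑ l, if i < l then M.base.b l else 0 := by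
    intro i
    rw [← hb, sub_eq_iff_eq_add, ← Finset.sum_filter, ← Finset.sum_filter_add_sum_filter_not
      Finset.univ (fun l => i < l)]
    congr 1
    refine Finset.sum_congr ?_ fun _ _ => rfl
    ext l; simp
  simp only [dotProduct, d, h, stage_fastOp, unitIntegral_slowOp, Finset.mul_sum, Finset.sum_mul]
  rw [Finset.sum_comm]
  refine Finset.sum_congr rfl fun i _ => Finset.sum_congr rfl fun j _ => ?_
  split_ifs <;> ring

end Operators

end MRIGARK

/-! ### Internal consistency and time -/

namespace MRIGARK

section Consistency

open Polynomial

variable {s : ℕ} (M : MRIGARK s)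

/-- Internal consistency says that constant slow tendencies are reproduced exactly. -/
theorem sum_γ_eq_C (hM : M.InternallyConsistent) (i : Fin s) :
    ∑ j, M.γ i j = C (M.base.Δc i) := by
  refine eq_of_infinite_eval_eq _ _ ((Set.Ioi_infinite (0 : ℝ)).mono fun x hx => ?_)
  -- the one-stage fast method with abscissa `x` compares both sides at `x`
  have h := hM 1 ⟨Matrix.of fun _ _ => x, 1⟩ (by simp)
  have h1 := congrFun h.1 i
  have h2 := congrFun h.2 (i, 0)
  have hx' : x ≠ 0 := ne_of_gt hx
  have e : ∀ j : Fin s, (if j < i then M.base.Δc j else if j = i then M.base.Δc i * x else 0) =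
      (if j < i then M.base.Δc j else 0) + if j = i then M.base.Δc i * x else 0 := by
    intro j
    rcases lt_trichotomy j i with h | h | h
    · simp [h, h.ne]
    · simp [h]
    · simp [h.not_gt, h.ne']
  simp only [mulVec, dotProduct, Asf, Aff, Afs, Fintype.sum_prod_type, RungeKutta.c, of_apply,
    Pi.one_apply, mul_one, Finset.univ_unique, Finset.sum_singleton, Finset.sum_add_distrib,
    ← Finset.mul_sum, e] at h1 h2
  rw [← h1] at h2
  simp only [Finset.sum_ite_eq', Finset.mem_univ, if_true, add_right_inj] at h2
  simp only [Set.mem_ofPred_eq, eval_finsetSum, eval_C]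
  exact (mul_left_cancel₀ hx' (by linarith [h2])).symm

theorem slowRhs_one (hM : M.InternallyConsistent) :
    M.slowRhs 1 = M.fastRhs 1 := by
  ext1 i
  simp [slowRhs_apply, fastRhs_apply, M.sum_γ_eq_C hM, smul_eq_C_mul]

theorem c_eq_zero (i : Fin s) (hi : (i : ℕ) = 0) : M.base.c i = 0 := by
  have h : ∀ k : Fin s, ¬ k < i := fun k hk => by
    have : (k : ℕ) < i := hk
    omega
  simp [RungeKutta.c, mulVec, dotProduct, A_apply, h]

theorem c_nonneg (i : Fin s) : 0 ≤ M.base.c i := by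
  have hs : 0 < s := i.pos
  rw [← M.c_eq_zero ⟨0, hs⟩ rfl]
  exact M.c_mono (Nat.zero_le _)

/-- The times `c₁, …, cₛ, 1` of the slow stages and of the new solution. -/
noncomputable def cNode (k : Fin (s + 1)) : ℝ := if h : (k : ℕ) < s then M.base.c ⟨k, h⟩ else 1

theorem cNode_castSucc (i : Fin s) : M.cNode i.castSucc = M.base.c i := by
  simp [cNode]

theorem cNode_succ (i : Fin s) : M.cNode i.succ = M.base.cNext i := by
  simp [cNode, RungeKutta.cNext]

theorem cNode_last : M.cNode (Fin.last s) = 1 := by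
  simp [cNode]

theorem cNode_zero (hs : 0 < s) : M.cNode 0 = 0 := by
  simp [cNode, hs, M.c_eq_zero]

theorem cNext_le_one (i : Fin s) : M.base.cNext i ≤ 1 := by
  rw [RungeKutta.cNext]
  split_ifs
  · exact M.c_le_one _
  · exact le_rfl

theorem Δc_nonneg (i : Fin s) : 0 ≤ M.base.Δc i := by
  rw [RungeKutta.Δc, RungeKutta.cNext]
  split_ifs
  · exact sub_nonneg.2 (M.c_mono (Fin.mk_le_mk.2 (Nat.le_succ _)))
  · exact sub_nonneg.2 (M.c_le_one _)

theorem timePoly_eval (i : Fin s) (x : ℝ) :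
    (M.timePoly i).eval x = M.base.c i + M.base.Δc i * x := by
  simp [timePoly]

theorem timePoly_eval_mem_Icc (i : Fin s) {x : ℝ} (hx : x ∈ Set.Icc (0 : ℝ) 1) :
    (M.timePoly i).eval x ∈ Set.Icc (0 : ℝ) 1 := by
  rw [timePoly_eval]
  have h1 := M.Δc_nonneg i
  have h2 := M.c_nonneg i
  have h3 := M.cNext_le_one i
  have h4 : M.base.Δc i * x ≤ M.base.Δc i := mul_le_of_le_one_right h1 hx.2
  refine ⟨add_nonneg h2 (mul_nonneg h1 hx.1), ?_⟩
  rw [RungeKutta.Δc] at *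
  linarith

/-- The fast response to `tᵐ` is exact: it is `t ^ (m + 1) / (m + 1)`. -/
theorem chain_fastRhs_timePoly_pow (hs : 0 < s) (m : ℕ) :
    chainNode (M.fastRhs (M.timePoly ^ m)) = (fun k => M.cNode k ^ (m + 1) / (m + 1)) ∧
    chain (M.fastRhs (M.timePoly ^ m)) = (1 / ((m : ℝ) + 1)) • M.timePoly ^ (m + 1) := by
  have hm : (m : ℝ) + 1 ≠ 0 := by positivity
  refine chain_eq_of_derivative ?_ ?_ ?_ ?_
  · simp [M.cNode_zero hs]
  · intro i
    simp [timePoly_eval_zero, cNode_castSucc, div_eq_inv_mul]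
  · intro i
    simp [timePoly_eval_one, cNode_succ, div_eq_inv_mul]
  · intro i
    rw [Pi.smul_apply, Pi.pow_apply, derivative_smul, derivative_pow, fastRhs_apply, timePoly]
    simp only [derivative_add, derivative_C, derivative_mul, derivative_X, zero_mul, zero_add,
      mul_one, Nat.add_sub_cancel, Pi.pow_apply, timePoly, smul_eq_C_mul]
    have : C (1 / ((m : ℝ) + 1)) * C (((m + 1 : ℕ) : ℝ)) = 1 := by
      rw [← C_mul, ← C_1]
      congr 1
      push_cast
      field_simp
    linear_combination ((C (M.base.Δc i) * (C (M.base.c i) + C (M.base.Δc i) * X) ^ m)) * this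

theorem fastOp_timePoly_pow (hs : 0 < s) (m : ℕ) :
    M.fastOp (M.timePoly ^ m) = (1 / ((m : ℝ) + 1)) • M.timePoly ^ (m + 1) :=
  (M.chain_fastRhs_timePoly_pow hs m).2

theorem fastEnd_timePoly_pow (hs : 0 < s) (m : ℕ) :
    M.fastEnd (M.timePoly ^ m) = 1 / ((m : ℝ) + 1) := by
  rw [← chainNode_fastRhs_last, (M.chain_fastRhs_timePoly_pow hs m).1]
  simp [cNode_last]

theorem stage_timePoly_pow (m : ℕ) : stage (M.timePoly ^ m) = M.base.c ^ m := by
  ext i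
  simp [stage_apply, timePoly_eval_zero]

end Consistency

end MRIGARK

/-! ### Necessary order conditions of Runge–Kutta methods -/

/-- The coefficient of a power `H ^ k`, `k ≤ p`, in a local error of size `O(H ^ (p + 1))` is
zero. -/
theorem eq_zero_of_eventually_abs_pow_mul_le {a C : ℝ} {k p : ℕ} (hk : k ≤ p)
    (h : ∀ᶠ H in 𝓝[>] (0 : ℝ), |H ^ k * a| ≤ C * H ^ (p + 1)) : a = 0 := by
  have h1 : ∀ᶠ H in 𝓝[>] (0 : ℝ), |a| ≤ C * H ^ (p + 1 - k) := by
    filter_upwards [h, self_mem_nhdsWithin] with H hH hpos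
    have hpos : 0 < H := hpos
    rw [abs_mul, abs_of_pos (pow_pos hpos k)] at hH
    refine le_of_mul_le_mul_left (hH.trans_eq ?_) (pow_pos hpos k)
    rw [mul_left_comm, ← pow_add]
    congr 2
    omega
  have h2 : Filter.Tendsto (fun H : ℝ => C * H ^ (p + 1 - k)) (𝓝[>] 0) (𝓝 0) := by
    have : Continuous fun H : ℝ => C * H ^ (p + 1 - k) := by fun_prop
    have h3 := this.tendsto 0
    rw [zero_pow (by omega), mul_zero] at h3
    exact h3.mono_left nhdsWithin_le_nhds
  exact abs_eq_zero.1 (le_antisymm (ge_of_tendsto h2 h1) (abs_nonneg a))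

/-- The exact solution of the test system `y₁' = tᵐ`, `y₂' = κ tⁿ y₁`, `y₃' = μ y₂`. -/
noncomputable def testSolution (m n : ℕ) (κ μ t : ℝ) : ℝ × ℝ × ℝ :=
  (t ^ (m + 1) / (m + 1), κ * (t ^ (m + n + 2) / ((m + 1) * (m + n + 2))),
    μ * κ * (t ^ (m + n + 3) / ((m + 1) * (m + n + 2) * (m + n + 3))))

theorem hasDerivAt_testSolution (m n : ℕ) (κ μ t : ℝ) :
    HasDerivAt (testSolution m n κ μ) (t ^ m, κ * (t ^ n * (testSolution m n κ μ t).1),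
      μ * (testSolution m n κ μ t).2.1) t := by
  have h : ∀ (q : ℕ) (a : ℝ), HasDerivAt (fun t : ℝ => t ^ (q + 1) / a)
      ((q + 1 : ℕ) * t ^ q / a) t := fun q a => by
    simpa using (hasDerivAt_pow (q + 1) t).div_const a
  have e1 : t ^ m = (m + 1 : ℕ) * t ^ m / ((m : ℝ) + 1) := by
    push_cast; field_simp
  have e2 : κ * (t ^ n * (testSolution m n κ μ t).1) = κ * ((m + n + 1 + 1 : ℕ) * t ^ (m + n + 1) /
      (((m : ℝ) + 1) * (m + n + 2))) := by
    simp only [testSolution]; push_cast; field_simp; ring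
  have e3 : μ * (testSolution m n κ μ t).2.1 = μ * κ * ((m + n + 2 + 1 : ℕ) * t ^ (m + n + 2) /
      (((m : ℝ) + 1) * (m + n + 2) * (m + n + 3))) := by
    simp only [testSolution]; push_cast; field_simp; ring
  rw [e1, e2, e3]
  exact (h m _).prodMk (((h (m + n + 1) _).const_mul κ).prodMk ((h (m + n + 2) _).const_mul _))

namespace RungeKutta

variable {s : ℕ} {R : RungeKutta s}

/-- Applying the method to `y₁' = tᵐ`, `y₂' = tⁿ y₁`, `y₃' = y₂` gives the order conditions of
the trees `[τ, …, τ]`, `[τ, …, τ, [τ, …, τ]]` and `[[τ, …, τ, [τ, …, τ]]]`. -/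
theorem HasOrder.conditions {p : ℕ} (h : R.HasOrder p) (m n : ℕ) :
    (m + 1 ≤ p → R.b ⬝ᵥ R.c ^ m = 1 / ((m : ℝ) + 1)) ∧
    (m + n + 2 ≤ p → R.b ⬝ᵥ (R.c ^ n * R.A *ᵥ (R.c ^ m)) = 1 / (((m : ℝ) + 1) * (m + n + 2))) ∧
    (m + n + 3 ≤ p → R.b ⬝ᵥ (R.A *ᵥ (R.c ^ n * R.A *ᵥ (R.c ^ m))) =
      1 / (((m : ℝ) + 1) * (m + n + 2) * (m + n + 3))) := by
  obtain ⟨C, -, δ, hδ, H₀, hH₀, hC⟩ := h (ℝ × ℝ × ℝ) (fun t y => (t ^ m, t ^ n * y.1, y.2.1))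
    (by simp only [Function.uncurry_def]; fun_prop) 0 (testSolution m n 1 1)
    (Filter.Eventually.of_forall fun t => by simpa using hasDerivAt_testSolution m n 1 1 t)
  -- the stages and the result of a step of size `H`, from the zero initial value
  set Y : ℝ → Fin s → ℝ × ℝ × ℝ := fun H i => (H ^ (m + 1) * (R.A *ᵥ (R.c ^ m)) i,
    H ^ (m + n + 2) * (R.A *ᵥ (R.c ^ n * R.A *ᵥ (R.c ^ m))) i,
    H ^ (m + n + 3) * (R.A *ᵥ (R.A *ᵥ (R.c ^ n * R.A *ᵥ (R.c ^ m)))) i) with hY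
  set y₁ : ℝ → ℝ × ℝ × ℝ := fun H => (H ^ (m + 1) * (R.b ⬝ᵥ (R.c ^ m)),
    H ^ (m + n + 2) * (R.b ⬝ᵥ (R.c ^ n * R.A *ᵥ (R.c ^ m))),
    H ^ (m + n + 3) * (R.b ⬝ᵥ (R.A *ᵥ (R.c ^ n * R.A *ᵥ (R.c ^ m))))) with hy₁
  have h0 : testSolution m n 1 1 0 = 0 := by simp [testSolution]
  have hsum : ∀ (w : Fin s → ℝ) (H : ℝ),
      (0 : ℝ × ℝ × ℝ) + H • ∑ j, w j • ((0 + R.c j * H) ^ m, (0 + R.c j * H) ^ n * (Y H j).1,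
        (Y H j).2.1) = (H ^ (m + 1) * (w ⬝ᵥ (R.c ^ m)),
        H ^ (m + n + 2) * (w ⬝ᵥ (R.c ^ n * R.A *ᵥ (R.c ^ m))),
        H ^ (m + n + 3) * (w ⬝ᵥ (R.A *ᵥ (R.c ^ n * R.A *ᵥ (R.c ^ m))))) := by
    intro w H
    rw [zero_add, Prod.ext_iff, Prod.ext_iff]
    simp only [Prod.smul_fst, Prod.smul_snd, Prod.fst_sum, Prod.snd_sum, smul_eq_mul, dotProduct,
      Finset.mul_sum, hY]
    refine ⟨Finset.sum_congr rfl fun j _ => ?_, Finset.sum_congr rfl fun j _ => ?_,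
      Finset.sum_congr rfl fun j _ => ?_⟩
    · rw [Pi.pow_apply]; ring
    · rw [Pi.mul_apply, Pi.pow_apply]; ring
    · ring
  have hstep : ∀ H, R.IsStep (fun t y => (t ^ m, t ^ n * y.1, y.2.1)) 0 (testSolution m n 1 1 0) H
      (Y H) (y₁ H) := fun H => by
    rw [h0]
    exact ⟨fun i => (hsum (R.A i) H).symm, (hsum R.b H).symm⟩
  have hnear : ∀ᶠ H in 𝓝[>] (0 : ℝ), ∀ i, ‖Y H i - testSolution m n 1 1 0‖ ≤ δ := by
    rw [Filter.eventually_all]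
    intro i
    have hcont : Continuous fun H => ‖Y H i - testSolution m n 1 1 0‖ := by
      simp only [hY]; fun_prop
    have := hcont.tendsto 0
    rw [show Y 0 i - testSolution m n 1 1 0 = 0 by simp [hY, h0], norm_zero] at this
    exact (this.mono_left nhdsWithin_le_nhds).eventually_le_const hδ
  have herr : ∀ᶠ H in 𝓝[>] (0 : ℝ), ‖y₁ H - testSolution m n 1 1 H‖ ≤ C * H ^ (p + 1) := by
    filter_upwards [hnear, Ioc_mem_nhdsGT hH₀] with H hH hH'
    simpa using hC H hH'.1 hH'.2 (Y H) (y₁ H) (hstep H) hH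
  refine ⟨fun hp => ?_, fun hp => ?_, fun hp => ?_⟩
  · refine sub_eq_zero.1 (eq_zero_of_eventually_abs_pow_mul_le (C := C) hp
      (herr.mono fun H hH => ?_))
    refine le_trans (le_of_eq ?_) ((norm_fst_le _).trans hH)
    rw [Real.norm_eq_abs]
    congr 1
    simp only [hy₁, testSolution, Prod.fst_sub]
    ring
  · refine sub_eq_zero.1 (eq_zero_of_eventually_abs_pow_mul_le (C := C) hp
      (herr.mono fun H hH => ?_))
    refine le_trans (le_of_eq ?_) ((norm_fst_le _).trans ((norm_snd_le _).trans hH))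
    rw [Real.norm_eq_abs]
    congr 1
    simp only [hy₁, testSolution, Prod.fst_sub, Prod.snd_sub]
    ring
  · refine sub_eq_zero.1 (eq_zero_of_eventually_abs_pow_mul_le (C := C) hp
      (herr.mono fun H hH => ?_))
    refine le_trans (le_of_eq ?_) ((norm_snd_le _).trans ((norm_snd_le _).trans hH))
    rw [Real.norm_eq_abs]
    congr 1
    simp only [hy₁, testSolution, Prod.snd_sub]
    ring

theorem HasOrder.sum_b {p : ℕ} (h : R.HasOrder p) (hp : 1 ≤ p) : ∑ i, R.b i = 1 := by
  simpa [dotProduct] using (h.conditions 0 0).1 hp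

theorem HasOrder.pos {p : ℕ} (h : R.HasOrder p) (hp : 1 ≤ p) : 0 < s := by
  by_contra h0
  obtain rfl : s = 0 := by omega
  simpa using h.sum_b hp

end RungeKutta

/-! ### Necessary order conditions of MRI-GARK methods -/

namespace MRIGARK

section Necessity

open Polynomial

variable {s : ℕ} {M : MRIGARK s}

theorem hasDerivAt_chain_div (r : Fin s → ℝ[X]) (i : Fin s) (k : ℕ) {H : ℝ} (hH : 0 < H)
    (θ : ℝ) : HasDerivAt (fun θ => H ^ (k + 1) * (chain r i).eval (θ / H))
      (H ^ k * (r i).eval (θ / H)) θ := by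
  have h := ((chain r i).hasDerivAt (θ / H)).comp θ ((hasDerivAt_id θ).div_const H)
  rw [derivative_chain] at h
  refine (h.const_mul (H ^ (k + 1))).congr_deriv ?_
  field_simp
  ring

theorem exists_abs_eval_le (q : Fin s → ℝ[X]) :
    ∃ B, 0 ≤ B ∧ ∀ i, ∀ x ∈ Set.Icc (0 : ℝ) 1, |(q i).eval x| ≤ B := by
  have h : ∀ i, ∃ B, ∀ x ∈ Set.Icc (0 : ℝ) 1, |(q i).eval x| ≤ B := fun i => by
    obtain ⟨B, hB⟩ := isCompact_Icc.exists_bound_of_continuousOn (q i).continuous.continuousOn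
    exact ⟨B, hB⟩
  choose B hB using h
  exact ⟨∑ i, |B i|, Finset.sum_nonneg fun _ _ => abs_nonneg _, fun i x hx =>
    (hB i x hx).trans ((le_abs_self _).trans
      (Finset.single_le_sum (f := fun i => |B i|) (fun _ _ => abs_nonneg _) (Finset.mem_univ i)))⟩

theorem exists_abs_eval_matrix_le (g : Matrix (Fin s) (Fin s) ℝ[X]) :
    ∃ B, 0 ≤ B ∧ ∀ i j, ∀ x ∈ Set.Icc (0 : ℝ) 1, |(g i j).eval x| ≤ B := by
  choose B hB0 hB using fun i => exists_abs_eval_le fun j => g i j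
  exact ⟨∑ i, B i, Finset.sum_nonneg fun _ _ => hB0 _, fun i j x hx => (hB i j x hx).trans
    (Finset.single_le_sum (fun i _ => hB0 i) (Finset.mem_univ i))⟩

/-- Applying the method to `y₁' = tᵐ` (slow), `y₂' = (α₁ + α₂) tⁿ y₁` and `y₃' = (β₁ + β₂) y₂`,
where `α₁`, `β₁` are the slow and `α₂`, `β₂` the fast parts: the step is polynomial, and its
final values are integrals along the sub-steps. -/
theorem HasOrder.conditions {p : ℕ} (h : M.HasOrder p) (m n : ℕ) (α₁ α₂ β₁ β₂ : ℝ)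
    {y₁ y₂ : Fin s → ℝ[X]} (hy₁ : y₁ = M.slowOp (M.base.c ^ m))
    (hy₂ : y₂ = α₁ • M.slowOp (M.base.c ^ n * stage y₁) + α₂ • M.fastOp (M.timePoly ^ n * y₁)) :
    (m + n + 2 ≤ p → α₁ * (M.base.b ⬝ᵥ (M.base.c ^ n * stage y₁)) +
      α₂ * M.fastEnd (M.timePoly ^ n * y₁) = (α₁ + α₂) / (((m : ℝ) + 1) * (m + n + 2))) ∧
    (m + n + 3 ≤ p → β₁ * (M.base.b ⬝ᵥ stage y₂) + β₂ * M.fastEnd y₂ =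
      (β₁ + β₂) * (α₁ + α₂) / (((m : ℝ) + 1) * (m + n + 2) * (m + n + 3))) := by
  set fS : ℝ → ℝ × ℝ × ℝ → ℝ × ℝ × ℝ := fun t y => (t ^ m, α₁ * (t ^ n * y.1), β₁ * y.2.1) with hfS
  set fF : ℝ → ℝ × ℝ × ℝ → ℝ × ℝ × ℝ := fun t y => (0, α₂ * (t ^ n * y.1), β₂ * y.2.1) with hfF
  set r₁ := M.slowRhs (M.base.c ^ m) with hr₁
  set r₂ := α₁ • M.slowRhs (M.base.c ^ n * stage y₁) + α₂ • M.fastRhs (M.timePoly ^ n * y₁)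
    with hr₂
  set r₃ := β₁ • M.slowRhs (stage y₂) + β₂ • M.fastRhs y₂ with hr₃
  have hc₁ : chain r₁ = y₁ := by rw [hy₁, slowOp, LinearMap.comp_apply]
  have hc₂ : chain r₂ = y₂ := by
    rw [hr₂, map_add, map_smul, map_smul, hy₂, slowOp, fastOp, LinearMap.comp_apply,
      LinearMap.comp_apply]
  have hst₁ : ∀ j : Fin s, chainNode r₁ j.castSucc = stage y₁ j := fun j => by
    rw [← hc₁, stage_apply, eval_zero_chain]
  have hst₂ : ∀ j : Fin s, chainNode r₂ j.castSucc = stage y₂ j := fun j => by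
    rw [← hc₂, stage_apply, eval_zero_chain]
  obtain ⟨C, -, δ, hδ, H₀, hH₀, hC⟩ := h (ℝ × ℝ × ℝ) fF fS
    (by simp only [hfF, Function.uncurry_def]; fun_prop)
    (by simp only [hfS, Function.uncurry_def]; fun_prop) 0 (testSolution m n (α₁ + α₂) (β₁ + β₂))
    (Filter.Eventually.of_forall fun t => by
      refine (hasDerivAt_testSolution m n _ _ t).congr_deriv ?_
      simp only [hfF, hfS, Prod.mk_add_mk, zero_add, Prod.mk.injEq, true_and]
      constructor <;> ring)
  -- the slow stages and the fast solutions of a step of size `H`, from the zero initial value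
  set Y : ℝ → Fin (s + 1) → ℝ × ℝ × ℝ := fun H k => (H ^ (m + 1) * chainNode r₁ k,
    H ^ (m + n + 2) * chainNode r₂ k, H ^ (m + n + 3) * chainNode r₃ k) with hY
  set v : ℝ → Fin s → ℝ → ℝ × ℝ × ℝ := fun H i θ => (H ^ (m + 1) * (chain r₁ i).eval (θ / H),
    H ^ (m + n + 2) * (chain r₂ i).eval (θ / H), H ^ (m + n + 3) * (chain r₃ i).eval (θ / H))
    with hv
  have h0 : testSolution m n (α₁ + α₂) (β₁ + β₂) 0 = 0 := by simp [testSolution]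
  have hstep : ∀ H : ℝ, 0 < H → M.IsStep fF fS 0 (testSolution m n (α₁ + α₂) (β₁ + β₂) 0) H
      (Y H) (v H) := fun H hH => by
    refine ⟨by simp [hY, h0, chainNode_zero], fun i => ⟨?_, fun θ _ => ?_, ?_⟩⟩
    · simp [hv, hY, eval_zero_chain]
    · have hd := ((hasDerivAt_chain_div r₁ i m hH θ).prodMk
        ((hasDerivAt_chain_div r₂ i (m + n + 1) hH θ).prodMk
          (hasDerivAt_chain_div r₃ i (m + n + 2) hH θ))).hasDerivWithinAt (s := Set.Icc 0 H)
      refine hd.congr_deriv ?_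
      have htime : M.base.c i * H + M.base.Δc i * θ = H * (M.timePoly i).eval (θ / H) := by
        rw [timePoly_eval]; field_simp
      rw [Prod.ext_iff, Prod.ext_iff]
      simp only [hfF, hfS, Prod.smul_fst, Prod.smul_snd, Prod.fst_add, Prod.snd_add, Prod.fst_sum,
        Prod.snd_sum, smul_eq_mul, mul_zero, zero_add, htime]
      simp only [hv, hY, hst₁, hst₂, hc₁, hc₂]
      refine ⟨?_, ?_, ?_⟩
      · simp only [hr₁, slowRhs_apply, eval_finsetSum, eval_smul, Pi.pow_apply, smul_eq_mul,
          Finset.mul_sum]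
        exact Finset.sum_congr rfl fun j _ => by ring
      · simp only [hr₂, slowRhs_apply, fastRhs_apply, eval_finsetSum, eval_smul, Pi.pow_apply,
          smul_eq_mul, Finset.mul_sum, Pi.add_apply, Pi.smul_apply, eval_add, mul_add,
          Pi.mul_apply, eval_mul, eval_pow]
        rw [add_comm]
        congr 1
        · ring
        · exact Finset.sum_congr rfl fun j _ => by ring
      · simp only [hr₃, slowRhs_apply, fastRhs_apply, eval_finsetSum, eval_smul, smul_eq_mul,
          Finset.mul_sum, Pi.add_apply, Pi.smul_apply, eval_add, mul_add]
        rw [add_comm]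
        congr 1
        · ring
        · exact Finset.sum_congr rfl fun j _ => by ring
    · simp [hv, hY, eval_one_chain, hH.ne']
  have hnear : ∀ᶠ H in 𝓝[>] (0 : ℝ), ∀ i, ∀ θ ∈ Set.Icc 0 H,
      ‖v H i θ - testSolution m n (α₁ + α₂) (β₁ + β₂) 0‖ ≤ δ := by
    obtain ⟨B₁, hB₁, hb₁⟩ := exists_abs_eval_le (chain r₁)
    obtain ⟨B₂, hB₂, hb₂⟩ := exists_abs_eval_le (chain r₂)
    obtain ⟨B₃, hB₃, hb₃⟩ := exists_abs_eval_le (chain r₃)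
    have hlim : Filter.Tendsto (fun H : ℝ => H * (B₁ + B₂ + B₃)) (𝓝[>] 0) (𝓝 0) := by
      have : Continuous fun H : ℝ => H * (B₁ + B₂ + B₃) := by fun_prop
      have h3 := this.tendsto 0
      rw [zero_mul] at h3
      exact h3.mono_left nhdsWithin_le_nhds
    filter_upwards [hlim.eventually_le_const hδ, Ioc_mem_nhdsGT (zero_lt_one (α := ℝ))]
      with H hH hH1 i θ hθ
    have hx : θ / H ∈ Set.Icc (0 : ℝ) 1 :=
      ⟨div_nonneg hθ.1 hH1.1.le, (div_le_one hH1.1).2 hθ.2⟩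
    have hbd : ∀ (k : ℕ) (a B : ℝ), |a| ≤ B → B ≤ B₁ + B₂ + B₃ → ‖H ^ (k + 1) * a‖ ≤ δ := by
      intro k a B h1 h2
      rw [Real.norm_eq_abs, abs_mul, abs_of_nonneg (pow_nonneg hH1.1.le _)]
      refine le_trans (mul_le_mul ?_ (h1.trans h2) (abs_nonneg _) hH1.1.le) hH
      exact pow_le_of_le_one hH1.1.le hH1.2 (Nat.succ_ne_zero k)
    rw [h0, sub_zero, norm_prod_le_iff, norm_prod_le_iff]
    exact ⟨hbd m _ _ (hb₁ i _ hx) (by linarith), hbd (m + n + 1) _ _ (hb₂ i _ hx) (by linarith),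
      hbd (m + n + 2) _ _ (hb₃ i _ hx) (by linarith)⟩
  have herr : ∀ᶠ H in 𝓝[>] (0 : ℝ), ‖Y H (Fin.last s) - testSolution m n (α₁ + α₂) (β₁ + β₂) H‖ ≤
      C * H ^ (p + 1) := by
    filter_upwards [hnear, Ioc_mem_nhdsGT hH₀] with H hH hH'
    simpa using hC H hH'.1 hH'.2 (Y H) (v H) (hstep H hH'.1) hH
  have hend : ∀ (a b : ℝ) (σ : Fin s → ℝ) (g : Fin s → ℝ[X]),
      chainNode (a • M.slowRhs σ + b • M.fastRhs g) (Fin.last s) =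
        a * (M.base.b ⬝ᵥ σ) + b * M.fastEnd g := fun a b σ g => by
    rw [chainNode_add, chainNode_smul, chainNode_smul, chainNode_slowRhs_last,
      chainNode_fastRhs_last]
  refine ⟨fun hp => ?_, fun hp => ?_⟩
  · refine sub_eq_zero.1 (eq_zero_of_eventually_abs_pow_mul_le (C := C) hp
      (herr.mono fun H hH => ?_))
    refine le_trans (le_of_eq ?_) ((norm_fst_le _).trans ((norm_snd_le _).trans hH))
    rw [Real.norm_eq_abs]
    congr 1
    simp only [hY, testSolution, Prod.fst_sub, Prod.snd_sub, hr₂, hend]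
    ring
  · refine sub_eq_zero.1 (eq_zero_of_eventually_abs_pow_mul_le (C := C) hp
      (herr.mono fun H hH => ?_))
    refine le_trans (le_of_eq ?_) ((norm_snd_le _).trans ((norm_snd_le _).trans hH))
    rw [Real.norm_eq_abs]
    congr 1
    simp only [hY, testSolution, Prod.snd_sub, hr₃, hend]
    ring

end Necessity

end MRIGARK

/-! ### Necessity of the coupling conditions and of the order of the base method -/

namespace MRIGARK

section Coupling

open Polynomial

variable {s : ℕ} {M : MRIGARK s}

/-- The five coupling conditions are error terms of the triangular test systems. -/
theorem HasOrder.coupling (h : M.HasOrder 4) (hb : ∑ i, M.base.b i = 1) :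
    1 / 2 * (M.z ⬝ᵥ (M.base.A *ᵥ M.base.c)) +
        ∑ k ∈ Finset.range (maxDegree M.γ + 1),
          (M.base.Δc * (zetaCoeff k • M.base.c + omegaCoeff k • M.base.Δc)) ⬝ᵥ
            (gammaCoeff M.γ k *ᵥ M.base.c) = 1 / 8 ∧
      M.base.Δc ⬝ᵥ (M.frakA *ᵥ (M.base.c ^ 2)) = 1 / 12 ∧
      M.d ⬝ᵥ (M.frakA *ᵥ M.base.c) = 1 / 24 ∧
      (M.base.Δc ^ 2) ⬝ᵥ (((1 / 2 : ℝ) • M.base.A + gammaSum M.γ xiCoeff) *ᵥ M.base.c) +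
        M.t ⬝ᵥ (M.frakA *ᵥ M.base.c) = 1 / 24 ∧
      M.base.Δc ⬝ᵥ (M.frakA *ᵥ (M.base.A *ᵥ M.base.c)) = 1 / 24 := by
  have hc : M.base.c ^ 1 = M.base.c := pow_one _
  refine ⟨?_, ?_, ?_, ?_, ?_⟩
  · have := (h.conditions 1 1 0 1 0 0 rfl rfl).1 (by norm_num)
    rw [hc, pow_one, zero_mul, one_mul, zero_add, fastEnd_timePoly_mul_slowOp] at this
    rw [this]; norm_num
  · have := (h.conditions 2 0 0 1 0 0 rfl rfl).1 (by norm_num)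
    rw [pow_zero, pow_zero, one_mul, one_mul, zero_mul, one_mul, zero_add, fastEnd_slowOp] at this
    rw [this]; norm_num
  · have := (h.conditions 1 0 0 1 1 0 rfl rfl).2 (by norm_num)
    rw [hc, pow_zero, pow_zero, one_mul, one_mul, zero_mul, one_mul, add_zero, zero_smul, one_smul,
      zero_add, dotProduct_stage_fastOp_slowOp _ hb] at this
    rw [this]; norm_num
  · have := (h.conditions 1 0 0 1 0 1 rfl rfl).2 (by norm_num)
    rw [hc, pow_zero, pow_zero, one_mul, one_mul, zero_mul, one_mul, zero_add, zero_smul, one_smul,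
      zero_add, fastEnd_fastOp_slowOp] at this
    rw [this]; norm_num
  · have := (h.conditions 1 0 1 0 0 1 rfl rfl).2 (by norm_num)
    rw [hc, pow_zero, pow_zero, one_mul, one_mul, zero_mul, one_mul, zero_add, zero_smul, one_smul,
      add_zero, stage_slowOp, fastEnd_slowOp] at this
    rw [this]; norm_num

/-- For a vanishing fast process a step of the MRI-GARK method is a step of the slow base
method. -/
theorem HasOrder.base {p : ℕ} (h : M.HasOrder p) : M.base.HasOrder p := by
  intro E _ _ _ f hf t₀ y hy
  obtain ⟨C, hC, δ, hδ, H₀, hH₀, hM⟩ :=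
    h E 0 f (by exact contDiff_const) hf t₀ y (by simpa using hy)
  -- `f` is bounded near `(t₀, y t₀)`
  obtain ⟨K, ρ, hK, hρ, hbd⟩ : ∃ K ρ : ℝ, 0 ≤ K ∧ 0 < ρ ∧ ∀ t z, |t - t₀| ≤ ρ → ‖z - y t₀‖ ≤ ρ →
      ‖f t z‖ ≤ K := by
    have hc := (hf.continuous.tendsto (t₀, y t₀)).norm.eventually_le_const
      (lt_add_one ‖f t₀ (y t₀)‖)
    obtain ⟨ρ, hρ, hball⟩ := Metric.eventually_nhds_iff.1 hc
    refine ⟨‖f t₀ (y t₀)‖ + 1, ρ / 2, by positivity, half_pos hρ, fun t z ht hz => ?_⟩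
    refine hball (y := (t, z)) ?_
    rw [Prod.dist_eq, max_lt_iff, Real.dist_eq, dist_eq_norm]
    constructor <;> linarith
  obtain ⟨B, hB⟩ : ∃ B, 0 ≤ B ∧ ∀ i j, ∀ x ∈ Set.Icc (0 : ℝ) 1,
      |(antideriv (M.γ i j)).eval x| ≤ B :=
    exists_abs_eval_matrix_le (M.γ.map antideriv)
  -- `φ` below is bounded by `K`, so the stages of the extended step move by at most `s B K H`
  set H₁ := min (min H₀ ρ) (δ / 2 / (s * (B * K) + 1)) with hH₁
  have hpos : 0 < (s : ℝ) * (B * K) + 1 := by have := hB.1; positivity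
  refine ⟨C, hC, min ρ (δ / 2), lt_min hρ (half_pos hδ), H₁, by positivity, ?_⟩
  intro H hH hHle Y y₁ hstep hnear
  have hHH₀ : H ≤ H₀ := hHle.trans ((min_le_left _ _).trans (min_le_left _ _))
  have hHρ : H ≤ ρ := hHle.trans ((min_le_left _ _).trans (min_le_right _ _))
  have hHδ : H * (s * (B * K)) ≤ δ / 2 := by
    have := (le_div_iff₀ hpos).1 (hHle.trans (min_le_right _ _))
    nlinarith
  set φ : Fin s → E := fun j => f (t₀ + M.base.c j * H) (Y j) with hφ
  have hφK : ∀ j, ‖φ j‖ ≤ K := fun j => by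
    refine hbd _ _ ?_ ((hnear j).trans (min_le_left _ _))
    rw [add_sub_cancel_left, abs_of_nonneg (mul_nonneg (M.c_nonneg j) hH.le)]
    nlinarith [M.c_le_one j, M.c_nonneg j]
  -- the stages of the base method and its result, as partial sums of the increments `Γ̄`
  set Z : Fin (s + 1) → E := fun k =>
    y t₀ + H • ∑ j, (∑ l : Fin s, if (l : ℕ) < k then unitIntegral (M.γ l j) else 0) • φ j with hZ
  have hZY : ∀ j : Fin s, Z j.castSucc = Y j := fun j => by
    rw [hstep.1 j]
    simp only [hZ, A_apply, Fin.val_castSucc, Fin.val_fin_lt, hφ]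
  have hZl : Z (Fin.last s) = y₁ := by
    rw [hstep.2]
    simp only [hZ, b_apply, Fin.val_last, Fin.is_lt, if_true, hφ]
  set v : Fin s → ℝ → E := fun i θ => Z i.castSucc +
    H • ∑ j, (antideriv (M.γ i j)).eval (θ / H) • φ j with hv
  rw [← hZl]
  refine hM H hH hHH₀ Z v ⟨by simp [hZ], fun i => ⟨by simp [hv], fun θ _ => ?_, ?_⟩⟩
    fun i θ hθ => ?_
  · have hd : ∀ j, HasDerivAt (fun θ => (antideriv (M.γ i j)).eval (θ / H) • φ j)
        (((M.γ i j).eval (θ / H) * (1 / H)) • φ j) θ := fun j => by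
      have h := ((antideriv (M.γ i j)).hasDerivAt (θ / H)).comp θ ((hasDerivAt_id θ).div_const H)
      rw [derivative_antideriv] at h
      exact h.smul_const (φ j)
    refine (((HasDerivAt.fun_sum fun j _ => hd j).const_smul H).const_add
      (Z i.castSucc)).hasDerivWithinAt.congr_deriv ?_
    simp only [Pi.zero_apply, smul_zero, zero_add, hZY, Finset.smul_sum, smul_smul]
    refine Finset.sum_congr rfl fun j _ => ?_
    rw [mul_one_div, mul_div_cancel₀ _ hH.ne']
  · have hn := fun j : Fin s => chainNode_succ (fun l => M.γ l j) i
    simp only [chainNode] at hn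
    simp only [hv, hZ, hn, add_smul, Finset.sum_add_distrib, smul_add, add_assoc, div_self hH.ne',
      ← unitIntegral_apply]
  · have hx : θ / H ∈ Set.Icc (0 : ℝ) 1 := ⟨div_nonneg hθ.1 hH.le, (div_le_one hH).2 hθ.2⟩
    have h1 : ‖Z i.castSucc - y t₀‖ ≤ δ / 2 := by
      rw [hZY]; exact (hnear i).trans (min_le_right _ _)
    have h2 : ‖H • ∑ j, (antideriv (M.γ i j)).eval (θ / H) • φ j‖ ≤ δ / 2 := by
      refine le_trans ?_ hHδ
      rw [norm_smul, Real.norm_of_nonneg hH.le]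
      refine mul_le_mul_of_nonneg_left ((norm_sum_le _ _).trans ?_) hH.le
      refine (Finset.sum_le_sum (g := fun _ => B * K) fun j _ => ?_).trans_eq (by simp)
      rw [norm_smul]
      exact mul_le_mul (hB.2 i j _ hx) (hφK j) (norm_nonneg _) hB.1
    calc ‖v i θ - y t₀‖
        = ‖(Z i.castSucc - y t₀) + H • ∑ j, (antideriv (M.γ i j)).eval (θ / H) • φ j‖ := by
          simp only [hv]; congr 1; abel
      _ ≤ δ / 2 + δ / 2 := (norm_add_le _ _).trans (add_le_add h1 h2)
      _ = δ := add_halves δ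

end Coupling

/-! ### Coupling conditions with a discretized fast process -/

section FastTableau

open Polynomial

variable {s σ : ℕ} {M : MRIGARK s}

/-- The sub-steps before the `i`-th one integrate `tᵐ` from `0` to `cᵢ`. -/
theorem sum_ite_Δc_mul_timePoly_pow (m : ℕ) (i : Fin s) :
    (∑ q, if q < i then M.base.Δc q * unitIntegral (M.timePoly q ^ m) else 0) =
      M.base.c i ^ (m + 1) / (m + 1) := by
  have h := M.stage_fastOp (M.timePoly ^ m) i
  rw [fastOp_timePoly_pow M i.pos, map_smul, stage_timePoly_pow] at h
  simp only [Pi.pow_apply] at h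
  rw [← h, Pi.smul_apply, Pi.pow_apply, smul_eq_mul]
  ring

theorem unitIntegral_timePoly (i : Fin s) :
    unitIntegral (M.timePoly i) = M.base.c i + M.base.Δc i / 2 := by
  rw [timePoly, map_add, unitIntegral_C, unitIntegral_C_mul, ← monomial_one_one_eq_X,
    unitIntegral_monomial]
  norm_num
  ring

theorem unitIntegral_timePoly_sq (i : Fin s) : unitIntegral (M.timePoly i ^ 2) =
    M.base.c i ^ 2 + M.base.c i * M.base.Δc i + M.base.Δc i ^ 2 / 3 := by
  have h : M.timePoly i ^ 2 = C (M.base.c i ^ 2) + monomial 1 (2 * M.base.c i * M.base.Δc i) +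
      monomial 2 (M.base.Δc i ^ 2) := by
    rw [timePoly, ← C_mul_X_pow_eq_monomial, ← C_mul_X_pow_eq_monomial]
    simp only [C_mul, C_pow, map_ofNat]
    ring
  rw [h, map_add, map_add, unitIntegral_C, unitIntegral_monomial, unitIntegral_monomial]
  norm_num
  ring

theorem Asf_mulVec_apply (F : RungeKutta σ) (u : Fin s × Fin σ → ℝ) (i : Fin s) :
    (M.Asf F *ᵥ u) i =
      ∑ q, if q < i then M.base.Δc q * (F.b ⬝ᵥ fun k => u (q, k)) else 0 := by
  simp only [mulVec, dotProduct, Asf, Fintype.sum_prod_type, of_apply, ite_mul, zero_mul,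
    Finset.mul_sum]
  refine Finset.sum_congr rfl fun q _ => ?_
  split_ifs
  · exact Finset.sum_congr rfl fun k _ => mul_assoc _ _ _
  · simp

theorem Aff_mulVec_apply (F : RungeKutta σ) (u : Fin s × Fin σ → ℝ) (i : Fin s) (k : Fin σ) :
    (M.Aff F *ᵥ u) (i, k) = (M.Asf F *ᵥ u) i + M.base.Δc i * (F.A *ᵥ fun l => u (i, l)) k := by
  have e : ∀ q : Fin s, (∑ l, (if q < i then M.base.Δc q * F.b l else
      if q = i then M.base.Δc i * F.A k l else 0) * u (q, l)) =
      (if q < i then M.base.Δc q * (F.b ⬝ᵥ fun k => u (q, k)) else 0) +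
      if q = i then M.base.Δc i * (F.A *ᵥ fun l => u (q, l)) k else 0 := by
    intro q
    rcases lt_trichotomy q i with h | h | h
    · simp [h, h.ne, dotProduct, Finset.mul_sum, mul_assoc]
    · simp [h, dotProduct, mulVec, Finset.mul_sum, mul_assoc]
    · simp [h.not_gt, h.ne']
  rw [Asf_mulVec_apply]
  simp only [mulVec, Aff, Fintype.sum_prod_type, of_apply, dotProduct] at e ⊢
  simp only [e, Finset.sum_add_distrib, Finset.sum_ite_eq', Finset.mem_univ, if_true]

variable {F : RungeKutta σ}

theorem cf_apply (hF : F.b ⬝ᵥ 1 = 1) (i : Fin s) (k : Fin σ) :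
    M.cf F (i, k) = M.base.c i + M.base.Δc i * F.c k := by
  have h := sum_ite_Δc_mul_timePoly_pow (M := M) 0 i
  have h1 : unitIntegral (1 : ℝ[X]) = 1 := by rw [← C_1, unitIntegral_C]
  simp only [pow_zero, h1, mul_one, zero_add, pow_one, Nat.cast_zero, div_one] at h
  rw [cf, Aff_mulVec_apply, Asf_mulVec_apply, ← h]
  congr 1
  refine Finset.sum_congr rfl fun q _ => ?_
  rw [show (fun k => (1 : Fin s × Fin σ → ℝ) (q, k)) = 1 from rfl, hF, mul_one]

theorem Asf_mulVec_cf (hF : F.b ⬝ᵥ 1 = 1) (hF' : F.b ⬝ᵥ F.c = 1 / 2) :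
    M.Asf F *ᵥ M.cf F = (1 / 2 : ℝ) • M.base.c ^ 2 := by
  ext i
  have h := sum_ite_Δc_mul_timePoly_pow (M := M) 1 i
  rw [Asf_mulVec_apply, Pi.smul_apply, Pi.pow_apply, smul_eq_mul]
  norm_num at h
  rw [one_div, mul_comm, ← div_eq_mul_inv, ← h]
  refine Finset.sum_congr rfl fun q _ => ?_
  have e : (fun k => M.cf F (q, k)) = M.base.c q • 1 + M.base.Δc q • F.c := by
    ext k; simp [cf_apply hF]
  rw [e, dotProduct_add, dotProduct_smul, dotProduct_smul, hF, hF', unitIntegral_timePoly]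
  simp only [smul_eq_mul]
  congr 1
  ring

theorem Asf_mulVec_cf_sq (hF : F.b ⬝ᵥ 1 = 1) (hF' : F.b ⬝ᵥ F.c = 1 / 2)
    (hF'' : F.b ⬝ᵥ F.c ^ 2 = 1 / 3) :
    M.Asf F *ᵥ (M.cf F ^ 2) = (1 / 3 : ℝ) • M.base.c ^ 3 := by
  ext i
  have h := sum_ite_Δc_mul_timePoly_pow (M := M) 2 i
  rw [Asf_mulVec_apply, Pi.smul_apply, Pi.pow_apply, smul_eq_mul]
  norm_num at h
  rw [one_div, mul_comm, ← div_eq_mul_inv, ← h]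
  refine Finset.sum_congr rfl fun q _ => ?_
  have e : (fun k => (M.cf F ^ 2) (q, k)) = M.base.c q ^ 2 • 1 +
      (2 * M.base.c q * M.base.Δc q) • F.c + M.base.Δc q ^ 2 • F.c ^ 2 := by
    ext k; simp [cf_apply hF]; ring
  rw [e, dotProduct_add, dotProduct_add, dotProduct_smul, dotProduct_smul, dotProduct_smul, hF,
    hF', hF'', unitIntegral_timePoly_sq]
  simp only [smul_eq_mul]
  congr 1
  ring

theorem Asf_mulVec_Aff_mulVec_cf (hF : F.b ⬝ᵥ 1 = 1) (hF' : F.b ⬝ᵥ F.c = 1 / 2)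
    (hF'' : F.b ⬝ᵥ (F.A *ᵥ F.c) = 1 / 6) :
    M.Asf F *ᵥ (M.Aff F *ᵥ M.cf F) = (1 / 6 : ℝ) • M.base.c ^ 3 := by
  ext i
  have h := sum_ite_Δc_mul_timePoly_pow (M := M) 2 i
  rw [Asf_mulVec_apply, Pi.smul_apply, Pi.pow_apply, smul_eq_mul]
  norm_num at h
  rw [show (1 / 6 : ℝ) * M.base.c i ^ 3 = 1 / 2 * (M.base.c i ^ 3 / 3) by ring, ← h, Finset.mul_sum]
  refine Finset.sum_congr rfl fun q _ => ?_
  have e : (fun k => (M.Aff F *ᵥ M.cf F) (q, k)) = (1 / 2 * M.base.c q ^ 2) • 1 +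
      (M.base.c q * M.base.Δc q) • F.c + M.base.Δc q ^ 2 • (F.A *ᵥ F.c) := by
    ext k
    have e' : (fun l => M.cf F (q, l)) = M.base.c q • 1 + M.base.Δc q • F.c := by
      ext k; simp [cf_apply hF]
    rw [Aff_mulVec_apply, Asf_mulVec_cf hF hF', e', mulVec_add, mulVec_smul, mulVec_smul]
    simp only [Pi.add_apply, Pi.smul_apply, Pi.pow_apply, Pi.one_apply, smul_eq_mul,
      show (F.A *ᵥ 1) k = F.c k from rfl]
    ring
  rw [e, dotProduct_add, dotProduct_add, dotProduct_smul, dotProduct_smul, dotProduct_smul, hF,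
    hF', hF'', unitIntegral_timePoly_sq]
  simp only [smul_eq_mul, mul_ite, mul_zero]
  congr 1
  ring

/-- The weights of the discretized fast process act on `γᵢⱼ` as the double integral, because the
fast method integrates the trees `[𝔱ₖ]` exactly up to the degree of `γᵢⱼ`. -/
theorem bf_dotProduct_Afs_mulVec (hF : F.b ⬝ᵥ 1 = 1)
    (hk : ∀ k ≤ maxDegree M.γ, F.b ⬝ᵥ (F.A *ᵥ (F.c ^ k)) = zetaCoeff k) (w : Fin s → ℝ) :
    M.bf F ⬝ᵥ (M.Afs F *ᵥ w) = M.base.Δc ⬝ᵥ (M.frakA *ᵥ w) := by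
  let L : ℝ[X] →ₗ[ℝ] ℝ := ∑ k, ∑ l, (F.b k * F.A k l) • leval (F.c l)
  have hL : ∀ p, L p = ∑ k, F.b k * ∑ l, F.A k l * p.eval (F.c l) := fun p => by
    simp [L, LinearMap.sum_apply, Finset.mul_sum, mul_assoc]
  have hL' : ∀ i j, gammaSum M.γ zetaCoeff i j = L (M.γ i j) := gammaSum_apply_eq M.γ L
    fun k hkK a => by
      rw [hL, ← hk k hkK]
      simp only [dotProduct, mulVec, Finset.mul_sum, Finset.sum_mul, eval_monomial, Pi.pow_apply]
      exact Finset.sum_congr rfl fun _ _ => Finset.sum_congr rfl fun _ _ => by ring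
  have hF1 : ∑ k, F.b k = 1 := by simpa [dotProduct] using hF
  have e : ∀ i j, M.frakA i j = ∑ k, F.b k * M.Afs F (i, k) j := fun i j => by
    simp only [frakA, Matrix.add_apply, hL', hL, Afs, of_apply, mul_add, Finset.sum_add_distrib,
      ← Finset.sum_mul, hF1, one_mul]
  simp only [dotProduct, mulVec, bf, Fintype.sum_prod_type, e, Finset.mul_sum, Finset.sum_mul]
  refine Finset.sum_congr rfl fun i _ => ?_
  rw [Finset.sum_comm]
  exact Finset.sum_congr rfl fun _ _ => Finset.sum_congr rfl fun _ _ => by ring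

/-- The coupling conditions that involve the fast method. The first four are quadratures of powers
of `t` by the fast method, hence order conditions of the base method. -/
theorem discretized_coupling (h : M.base.HasOrder 4) (hF : F.HasOrder (maxDegree M.γ + 3)) :
    M.base.b ⬝ᵥ (M.base.c * (M.Asf F *ᵥ M.cf F)) = 1 / 8 ∧
      M.base.b ⬝ᵥ (M.Asf F *ᵥ (M.cf F ^ 2)) = 1 / 12 ∧
      M.base.b ⬝ᵥ (M.base.A *ᵥ (M.Asf F *ᵥ M.cf F)) = 1 / 24 ∧
      M.base.b ⬝ᵥ (M.Asf F *ᵥ (M.Aff F *ᵥ M.cf F)) = 1 / 24 ∧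
      (M.bf F ⬝ᵥ (M.Afs F *ᵥ (M.Asf F *ᵥ M.cf F)) = 1 / 24 ↔
        M.base.Δc ⬝ᵥ (M.frakA *ᵥ (M.base.c ^ 2)) = 1 / 12) := by
  have h1 : F.b ⬝ᵥ 1 = 1 := by simpa using (hF.conditions 0 0).1 (by omega)
  have h2 : F.b ⬝ᵥ F.c = 1 / 2 := by
    have := (hF.conditions 1 0).1 (by omega)
    rw [pow_one] at this; rw [this]; norm_num
  have h3 : F.b ⬝ᵥ F.c ^ 2 = 1 / 3 := by
    rw [(hF.conditions 2 0).1 (by omega)]; norm_num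
  have hk : ∀ k ≤ maxDegree M.γ + 1, F.b ⬝ᵥ (F.A *ᵥ (F.c ^ k)) = zetaCoeff k := fun k hk => by
    have := (hF.conditions k 0).2.1 (by omega)
    rw [pow_zero, one_mul] at this
    rw [this, zetaCoeff_eq, Nat.cast_zero, add_zero]
  have h4 : F.b ⬝ᵥ (F.A *ᵥ F.c) = 1 / 6 := by
    have := hk 1 (by omega)
    rw [pow_one, zetaCoeff_eq] at this; rw [this]; norm_num
  have b3 : M.base.b ⬝ᵥ M.base.c ^ 3 = 1 / 4 := by
    rw [(h.conditions 3 0).1 (by norm_num)]; norm_num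
  have b2 : M.base.b ⬝ᵥ (M.base.A *ᵥ (M.base.c ^ 2)) = 1 / 12 := by
    have := (h.conditions 2 0).2.1 (by norm_num)
    rw [pow_zero, one_mul] at this; rw [this]; norm_num
  rw [Asf_mulVec_cf_sq h1 h2 h3, Asf_mulVec_Aff_mulVec_cf h1 h2 h4, Asf_mulVec_cf h1 h2,
    bf_dotProduct_Afs_mulVec h1 fun k hkK => hk k (by omega)]
  simp only [mul_smul_comm, mulVec_smul, dotProduct_smul, b3, b2, smul_eq_mul,
    ← pow_succ' M.base.c 2]
  norm_num [b3]
  constructor <;> intro h <;> linarith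

end FastTableau

end MRIGARK

/-! ### Vector-valued functions on the sub-steps -/

section VectorChain

open Polynomial

variable {E : Type*} [NormedAddCommGroup E] [NormedSpace ℝ E] {s : ℕ}

/-- `w` is a function on the sub-steps (each parametrized by `[0, 1]`) that is continuous across
them, vanishes at the beginning, has the values `W` at the ends of the sub-steps and the
derivative `w'`. -/
structure IsVectorChain (w : Fin s → ℝ → E) (W : Fin (s + 1) → E) (w' : Fin s → ℝ → E) : Prop where
  zero : W 0 = 0
  left : ∀ i, w i 0 = W i.castSucc
  right : ∀ i, w i 1 = W i.succ
  deriv : ∀ i, ∀ x ∈ Set.Icc (0 : ℝ) 1, HasDerivWithinAt (w i) (w' i x) (Set.Icc 0 1) x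

namespace IsVectorChain

variable {w₁ w₂ w₁' w₂' : Fin s → ℝ → E} {W₁ W₂ : Fin (s + 1) → E}

theorem add (h₁ : IsVectorChain w₁ W₁ w₁') (h₂ : IsVectorChain w₂ W₂ w₂') :
    IsVectorChain (w₁ + w₂) (W₁ + W₂) (w₁' + w₂') where
  zero := by simp [h₁.zero, h₂.zero]
  left i := by simp [h₁.left, h₂.left]
  right i := by simp [h₁.right, h₂.right]
  deriv i x hx := (h₁.deriv i x hx).add (h₂.deriv i x hx)

theorem sub (h₁ : IsVectorChain w₁ W₁ w₁') (h₂ : IsVectorChain w₂ W₂ w₂') :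
    IsVectorChain (w₁ - w₂) (W₁ - W₂) (w₁' - w₂') where
  zero := by simp [h₁.zero, h₂.zero]
  left i := by simp [h₁.left, h₂.left]
  right i := by simp [h₁.right, h₂.right]
  deriv i x hx := (h₁.deriv i x hx).sub (h₂.deriv i x hx)

theorem const_smul (a : ℝ) (h₁ : IsVectorChain w₁ W₁ w₁') :
    IsVectorChain (a • w₁) (a • W₁) (a • w₁') where
  zero := by simp [h₁.zero]
  left i := by simp [h₁.left]
  right i := by simp [h₁.right]
  deriv i x hx := (h₁.deriv i x hx).const_smul a

/-- A bound on the derivative bounds the function, with the number of sub-steps as factor. -/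
theorem norm_le {B : ℝ} (h₁ : IsVectorChain w₁ W₁ w₁') (hB : 0 ≤ B)
    (hw : ∀ i, ∀ x ∈ Set.Icc (0 : ℝ) 1, ‖w₁' i x‖ ≤ B) :
    (∀ k, ‖W₁ k‖ ≤ s * B) ∧ ∀ i, ∀ x ∈ Set.Icc (0 : ℝ) 1, ‖w₁ i x‖ ≤ s * B := by
  have hstep : ∀ i, ∀ x ∈ Set.Icc (0 : ℝ) 1, ‖w₁ i x‖ ≤ ‖W₁ i.castSucc‖ + B := by
    intro i x hx
    have h := (convex_Icc (0 : ℝ) 1).norm_image_sub_le_of_norm_hasDerivWithin_le (h₁.deriv i)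
      (hw i) (Set.left_mem_Icc.2 zero_le_one) hx
    rw [h₁.left, sub_zero, Real.norm_of_nonneg hx.1] at h
    calc ‖w₁ i x‖ = ‖W₁ i.castSucc + (w₁ i x - W₁ i.castSucc)‖ := by congr 1; abel
      _ ≤ ‖W₁ i.castSucc‖ + B * x := (norm_add_le _ _).trans (by gcongr)
      _ ≤ ‖W₁ i.castSucc‖ + B := by gcongr; exact mul_le_of_le_one_right hB hx.2
  have hnode : ∀ k : Fin (s + 1), ‖W₁ k‖ ≤ (k : ℕ) * B := by
    intro k
    induction k using Fin.induction with
    | zero => simp [h₁.zero]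
    | succ i ih =>
      rw [← h₁.right]
      refine (hstep i 1 (Set.right_mem_Icc.2 zero_le_one)).trans ?_
      rw [Fin.val_succ]
      push_cast
      rw [Fin.val_castSucc] at ih
      linarith
  refine ⟨fun k => (hnode k).trans (by gcongr; omega), fun i x hx => ?_⟩
  refine (hstep i x hx).trans ?_
  have h1 := hnode i.castSucc
  have h2 : ((i : ℕ) + 1 : ℝ) * B ≤ s * B := by
    gcongr
    exact_mod_cast i.isLt
  rw [Fin.val_castSucc] at h1
  linarith

end IsVectorChain

/-- The function on the sub-steps with scalar profile `g` and direction `u`. -/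
noncomputable def profile (g : Fin s → ℝ[X]) (u : E) : Fin s → ℝ → E := fun i x => (g i).eval x • u

theorem isVectorChain_profile (r : Fin s → ℝ[X]) (u : E) :
    IsVectorChain (profile (chain r) u) (fun k => chainNode r k • u) (profile r u) where
  zero := by simp [chainNode_zero]
  left i := by simp [profile, eval_zero_chain]
  right i := by simp [profile, eval_one_chain]
  deriv i x _ := by
    have h := (chain r i).hasDerivAt x
    rw [derivative_chain] at h
    exact (h.smul_const u).hasDerivWithinAt

theorem exists_norm_profile_le (g : Fin s → ℝ[X]) (u : E) :
    ∃ B, 0 ≤ B ∧ ∀ i, ∀ x ∈ Set.Icc (0 : ℝ) 1, ‖profile g u i x‖ ≤ B := by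
  obtain ⟨B, hB, h⟩ := MRIGARK.exists_abs_eval_le g
  refine ⟨B * ‖u‖, by positivity, fun i x hx => ?_⟩
  rw [profile, norm_smul]
  exact mul_le_mul_of_nonneg_right (h i x hx) (norm_nonneg u)

/-- The linear right-hand side `aᵢ(x) J qᵢ(x) + ∑ⱼ gᵢⱼ(x) P qⱼ(0)`. -/
noncomputable def linearRhs (a : Fin s → ℝ[X]) (g : Fin s → Fin s → ℝ[X]) (J P : E →L[ℝ] E)
    (q : Fin s → ℝ → E) : Fin s → ℝ → E :=
  fun i x => (a i).eval x • J (q i x) + ∑ j, (g i j).eval x • P (q j 0)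

variable (a : Fin s → ℝ[X]) (g : Fin s → Fin s → ℝ[X]) (J P : E →L[ℝ] E)

theorem linearRhs_add (q q' : Fin s → ℝ → E) :
    linearRhs a g J P (q + q') = linearRhs a g J P q + linearRhs a g J P q' := by
  ext i x
  simp only [linearRhs, Pi.add_apply, map_add, smul_add, Finset.sum_add_distrib]
  abel

theorem linearRhs_smul (b : ℝ) (q : Fin s → ℝ → E) :
    linearRhs a g J P (b • q) = b • linearRhs a g J P q := by
  ext i x
  simp only [linearRhs, Pi.smul_apply, map_smul, smul_add, Finset.smul_sum, smul_comm _ b]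

theorem linearRhs_sub (q q' : Fin s → ℝ → E) :
    linearRhs a g J P (q - q') = linearRhs a g J P q - linearRhs a g J P q' := by
  ext i x
  simp only [linearRhs, Pi.sub_apply, map_sub, smul_sub, Finset.sum_sub_distrib]
  abel

theorem exists_norm_linearRhs_le : ∃ K, 0 ≤ K ∧ ∀ (q : Fin s → ℝ → E) (B : ℝ),
    (∀ i, ∀ x ∈ Set.Icc (0 : ℝ) 1, ‖q i x‖ ≤ B) →
      ∀ i, ∀ x ∈ Set.Icc (0 : ℝ) 1, ‖linearRhs a g J P q i x‖ ≤ K * B := by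
  obtain ⟨A, hA, ha⟩ := MRIGARK.exists_abs_eval_le a
  choose G hG hg using fun i => MRIGARK.exists_abs_eval_le (g i)
  refine ⟨A * ‖J‖ + ∑ i, s * (G i * ‖P‖), by
    have : 0 ≤ ∑ i, s * (G i * ‖P‖) := Finset.sum_nonneg fun i _ => by have := hG i; positivity
    positivity, fun q B hq i x hx => ?_⟩
  have hB : 0 ≤ B := (norm_nonneg _).trans (hq i x hx)
  have h1 : ‖(a i).eval x • J (q i x)‖ ≤ A * ‖J‖ * B := by
    rw [norm_smul, mul_assoc]
    exact mul_le_mul (ha i x hx) ((J.le_opNorm _).trans (by gcongr; exact hq i x hx))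
      (norm_nonneg _) hA
  have h2 : ∀ j, ‖(g i j).eval x • P (q j 0)‖ ≤ G i * ‖P‖ * B := fun j => by
    rw [norm_smul, mul_assoc]
    exact mul_le_mul (hg i j x hx) ((P.le_opNorm _).trans (by
      gcongr; exact hq j 0 (Set.left_mem_Icc.2 zero_le_one))) (norm_nonneg _) (hG i)
  have h3 : s * (G i * ‖P‖) ≤ ∑ i, s * (G i * ‖P‖) :=
    Finset.single_le_sum (f := fun i => s * (G i * ‖P‖))
      (fun i _ => by have := hG i; positivity) (Finset.mem_univ i)
  calc ‖linearRhs a g J P q i x‖ ≤ A * ‖J‖ * B + ∑ _j : Fin s, G i * ‖P‖ * B :=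
        (norm_add_le _ _).trans (add_le_add h1 ((norm_sum_le _ _).trans
          (Finset.sum_le_sum fun j _ => h2 j)))
    _ = (A * ‖J‖ + s * (G i * ‖P‖)) * B := by
        rw [Finset.sum_const, Finset.card_univ, Fintype.card_fin, nsmul_eq_mul]; ring
    _ ≤ _ := by gcongr

theorem le_two_mul_of_forall_le_half_add {ι : Type*} {f : ι → ℝ} {b D : ℝ} (hb : 0 ≤ b)
    (hD : 0 ≤ D) (hf : ∀ i, f i ≤ b)
    (h : ∀ B, 0 ≤ B → B ≤ b → (∀ i, f i ≤ B) → ∀ i, f i ≤ B / 2 + D) (i : ι) : f i ≤ 2 * D := by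
  have hbdd : BddAbove (Set.range f) := ⟨b, by rintro _ ⟨j, rfl⟩; exact hf j⟩
  have hne : (Set.range f).Nonempty := ⟨f i, i, rfl⟩
  have hle : ∀ j, f j ≤ max 0 (sSup (Set.range f)) := fun j =>
    (le_csSup hbdd ⟨j, rfl⟩).trans (le_max_right _ _)
  have hsb : sSup (Set.range f) ≤ b := csSup_le hne (by rintro _ ⟨j, rfl⟩; exact hf j)
  have h1 := h _ (le_max_left _ _) (max_le hb hsb) hle
  have h2 : sSup (Set.range f) ≤ max 0 (sSup (Set.range f)) / 2 + D :=
    csSup_le hne (by rintro _ ⟨j, rfl⟩; exact h1 j)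
  have h3 := le_csSup hbdd ⟨i, rfl⟩
  rcases le_total 0 (sSup (Set.range f)) with h0 | h0
  · rw [max_eq_right h0] at h2; linarith
  · linarith

/-- Absorption: if every bound `B ≤ b` of a bounded function on the sub-steps improves to
`B / 2 + D`, then `2 D` is a bound. -/
theorem norm_le_two_mul_of_forall_le_half_add {F : Type*} [NormedAddCommGroup F]
    {w : Fin s → ℝ → F} {b D : ℝ} (hb : 0 ≤ b)
    (hD : 0 ≤ D) (hw : ∀ i, ∀ x ∈ Set.Icc (0 : ℝ) 1, ‖w i x‖ ≤ b)
    (h : ∀ B, 0 ≤ B → B ≤ b → (∀ i, ∀ x ∈ Set.Icc (0 : ℝ) 1, ‖w i x‖ ≤ B) →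
      ∀ i, ∀ x ∈ Set.Icc (0 : ℝ) 1, ‖w i x‖ ≤ B / 2 + D) :
    ∀ i, ∀ x ∈ Set.Icc (0 : ℝ) 1, ‖w i x‖ ≤ 2 * D := by
  intro i x hx
  refine le_two_mul_of_forall_le_half_add (ι := Fin s × Set.Icc (0 : ℝ) 1)
    (f := fun j => ‖w j.1 j.2‖) hb hD (fun j => hw j.1 j.2 j.2.2) ?_ (i, ⟨x, hx⟩)
  intro B hB hBb hBw j
  exact h B hB hBb (fun i x hx => hBw (i, ⟨x, hx⟩)) j.1 j.2 j.2.2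

end VectorChain

/-! ### The linearized error -/

namespace MRIGARK

section Error

open Polynomial

variable {s : ℕ} (M : MRIGARK s)

/-- The defect `∑ⱼ γᵢⱼ(x) cⱼᵐ - Δcᵢ (cᵢ + Δcᵢ x)ᵐ` of the slow tendency for the slow function
`tᵐ`. -/
noncomputable def defect (m : ℕ) : Fin s → ℝ[X] :=
  M.slowRhs (M.base.c ^ m) - M.fastRhs (M.timePoly ^ m)

/-- The error of the method for the slow function `tᵐ`. -/
noncomputable def powError (m : ℕ) : Fin s → ℝ[X] := chain (M.defect m)

/-- The final values of all terms of order at most four in the expansion of the error: each is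
the coefficient of a product of derivatives of `f^F`, `f^S` along the solution. -/
structure ErrorTermsVanish : Prop where
  pow₁ : chainNode (M.defect 1) (Fin.last s) = 0
  pow₂ : chainNode (M.defect 2) (Fin.last s) = 0
  pow₃ : chainNode (M.defect 3) (Fin.last s) = 0
  fast_pow₁ : M.fastEnd (M.powError 1) = 0
  slow_pow₁ : M.base.b ⬝ᵥ stage (M.powError 1) = 0
  fast_pow₂ : M.fastEnd (M.powError 2) = 0
  slow_pow₂ : M.base.b ⬝ᵥ stage (M.powError 2) = 0
  fast_fast : M.fastEnd (M.fastOp (M.powError 1)) = 0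
  slow_fast : M.base.b ⬝ᵥ stage (M.fastOp (M.powError 1)) = 0
  fast_slow : M.fastEnd (M.slowOp (stage (M.powError 1))) = 0
  slow_slow : M.base.b ⬝ᵥ stage (M.slowOp (stage (M.powError 1))) = 0
  fast_time : M.fastEnd (M.timePoly * M.powError 1) = 0
  slow_time : M.base.b ⬝ᵥ (M.base.c * stage (M.powError 1)) = 0

variable {M} {E : Type*} [NormedAddCommGroup E] [NormedSpace ℝ E]

variable (M) in
/-- The part of the linearized right-hand side of the error equation that does not depend on the
step size. -/
noncomputable def errorRhs (J P : E →L[ℝ] E) (q : Fin s → ℝ → E) : Fin s → ℝ → E :=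
  linearRhs (fun i => C (M.base.Δc i)) (fun i j => M.γ i j) J P q

variable (M) in
/-- The part of the linearized right-hand side of the error equation that is proportional to the
step size and stems from the change of the Jacobians with time. -/
noncomputable def errorRhsTime (J P : E →L[ℝ] E) (q : Fin s → ℝ → E) : Fin s → ℝ → E :=
  linearRhs (fun i => C (M.base.Δc i) * M.timePoly i) (fun i j => C (M.base.c j) * M.γ i j) J P q

theorem errorRhs_profile (J P : E →L[ℝ] E) (g : Fin s → ℝ[X]) (u : E) :
    M.errorRhs J P (profile g u) =
      profile (M.fastRhs g) (J u) + profile (M.slowRhs (stage g)) (P u) := by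
  ext i x
  simp only [errorRhs, linearRhs, profile, Pi.add_apply, fastRhs_apply, slowRhs_apply, stage_apply,
    eval_smul, eval_finsetSum, eval_C, smul_eq_mul, map_smul, Finset.sum_smul, mul_smul]
  congr 1
  exact Finset.sum_congr rfl fun j _ => smul_comm _ _ _

theorem errorRhsTime_profile (J P : E →L[ℝ] E) (g : Fin s → ℝ[X]) (u : E) :
    M.errorRhsTime J P (profile g u) =
      profile (M.fastRhs (M.timePoly * g)) (J u) +
        profile (M.slowRhs (M.base.c * stage g)) (P u) := by
  ext i x
  simp only [errorRhsTime, linearRhs, profile, Pi.add_apply, Pi.mul_apply, fastRhs_apply,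
    slowRhs_apply, stage_apply, eval_smul, eval_mul, eval_finsetSum, eval_C, smul_eq_mul, map_smul,
    Finset.sum_smul, mul_smul]
  congr 1
  exact Finset.sum_congr rfl fun j _ => by rw [smul_comm ((g j).eval 0)]

theorem errorRhs_add (J P : E →L[ℝ] E) (q q' : Fin s → ℝ → E) :
    M.errorRhs J P (q + q') = M.errorRhs J P q + M.errorRhs J P q' :=
  linearRhs_add _ _ _ _ _ _

/-- The coefficients of `H ^ 2`, `H ^ 3` and `H ^ 4` in the expansion of the error. They vanish at
the end of the step if all error terms of order at most four do. -/
theorem ErrorTermsVanish.exists_expansion (hM : M.ErrorTermsVanish) (J J₁ P P₁ : E →L[ℝ] E)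
    (u₁ u₂ u₃ : E) : ∃ (q₂ q₃ q₄ : Fin s → ℝ → E) (Q₂ Q₃ Q₄ : Fin (s + 1) → E),
      IsVectorChain q₂ Q₂ (profile (M.defect 1) u₁) ∧
      IsVectorChain q₃ Q₃ (profile (M.defect 2) u₂ + M.errorRhs J P q₂) ∧
      IsVectorChain q₄ Q₄ (profile (M.defect 3) u₃ + M.errorRhs J P q₃ +
        M.errorRhsTime J₁ P₁ q₂) ∧
      Q₂ (Fin.last s) = 0 ∧ Q₃ (Fin.last s) = 0 ∧ Q₄ (Fin.last s) = 0 := by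
  have hp : ∀ (r : Fin s → ℝ[X]) (u : E), chainNode r (Fin.last s) = 0 →
      ∃ Q, IsVectorChain (profile (chain r) u) Q (profile r u) ∧ Q (Fin.last s) = 0 :=
    fun r u h => ⟨_, isVectorChain_profile r u, by simp [h]⟩
  have hadd : ∀ {w₁ w₂ w₁' w₂' : Fin s → ℝ → E},
      (∃ Q, IsVectorChain w₁ Q w₁' ∧ Q (Fin.last s) = 0) →
      (∃ Q, IsVectorChain w₂ Q w₂' ∧ Q (Fin.last s) = 0) →
      ∃ Q, IsVectorChain (w₁ + w₂) Q (w₁' + w₂') ∧ Q (Fin.last s) = 0 := by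
    rintro _ _ _ _ ⟨Q, hQ, e⟩ ⟨Q', hQ', e'⟩
    exact ⟨_, hQ.add hQ', by simp [e, e']⟩
  have hfast : ∀ (g : Fin s → ℝ[X]) (u : E), M.fastEnd g = 0 →
      ∃ Q, IsVectorChain (profile (M.fastOp g) u) Q (profile (M.fastRhs g) u) ∧
        Q (Fin.last s) = 0 := fun g u h => hp _ u (by rw [chainNode_fastRhs_last, h])
  have hslow : ∀ (σ : Fin s → ℝ) (u : E), M.base.b ⬝ᵥ σ = 0 →
      ∃ Q, IsVectorChain (profile (M.slowOp σ) u) Q (profile (M.slowRhs σ) u) ∧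
        Q (Fin.last s) = 0 := fun σ u h => hp _ u (by rw [chainNode_slowRhs_last, h])
  obtain ⟨Q₂, h₂, e₂⟩ := hp _ u₁ hM.pow₁
  obtain ⟨Q₃, h₃, e₃⟩ := hadd (hp _ u₂ hM.pow₂)
    (hadd (hfast _ (J u₁) hM.fast_pow₁) (hslow _ (P u₁) hM.slow_pow₁))
  obtain ⟨Q₄, h₄, e₄⟩ := hadd (hadd (hp _ u₃ hM.pow₃)
    (hadd (hadd (hfast _ (J u₂) hM.fast_pow₂) (hslow _ (P u₂) hM.slow_pow₂))
      (hadd (hadd (hfast _ (J (J u₁)) hM.fast_fast) (hslow _ (P (J u₁)) hM.slow_fast))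
        (hadd (hfast _ (J (P u₁)) hM.fast_slow) (hslow _ (P (P u₁)) hM.slow_slow)))))
    (hadd (hfast _ (J₁ u₁) hM.fast_time) (hslow _ (P₁ u₁) hM.slow_time))
  rw [← errorRhs_profile] at h₃
  rw [← errorRhs_profile, ← errorRhs_profile, ← errorRhs_profile, ← errorRhs_add, ← errorRhs_add,
    ← errorRhsTime_profile] at h₄
  exact ⟨_, _, _, Q₂, Q₃, Q₄, h₂, h₃, h₄, e₂, e₃, e₄⟩

/-- Comparison of the error equation, with linear terms `a` and `H • b`, with the expansion up to
`H ^ 4`. -/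
theorem expansion_identity {V : Type*} [AddCommGroup V] [Module ℝ V] (H : ℝ)
    (a a₂ a₃ a₄ b b₂ b₃ b₄ f₁ f₂ f₃ r : V) :
    H • (a + H • b + H • f₁ + H ^ 2 • f₂ + H ^ 3 • f₃ + r) -
      (H ^ 2 • f₁ + H ^ 3 • (f₂ + a₂) + H ^ 4 • (f₃ + a₃ + b₂)) =
    H • ((a - (H ^ 2 • a₂ + H ^ 3 • a₃ + H ^ 4 • a₄)) +
      H • (b - (H ^ 2 • b₂ + H ^ 3 • b₃ + H ^ 4 • b₄)) + r + H ^ 4 • (a₄ + b₃ + H • b₄)) := by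
  module

/-- If all error terms of order at most four vanish, then every function on the sub-steps that
satisfies the linearized error equation up to a remainder quadratic in the error is `O(H ^ 5)` at
the end of the step. -/
theorem ErrorTermsVanish.exists_norm_last_le (hM : M.ErrorTermsVanish) (J J₁ P P₁ : E →L[ℝ] E)
    (u₁ u₂ u₃ : E) {K : ℝ} (hK : 0 ≤ K) :
    ∃ C > 0, ∃ H₀ > 0, ∀ H : ℝ, 0 < H → H ≤ H₀ → ∀ (ε R : Fin s → ℝ → E) (W : Fin (s + 1) → E),
      (∀ i, ∀ x ∈ Set.Icc (0 : ℝ) 1, ‖ε i x‖ ≤ 1) →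
      (∀ B, 0 ≤ B → (∀ i, ∀ x ∈ Set.Icc (0 : ℝ) 1, ‖ε i x‖ ≤ B) →
        ∀ i, ∀ x ∈ Set.Icc (0 : ℝ) 1, ‖R i x‖ ≤ K * (B ^ 2 + H ^ 2 * B + H ^ 4)) →
      IsVectorChain ε W (H • (M.errorRhs J P ε + H • M.errorRhsTime J₁ P₁ ε +
        H • profile (M.defect 1) u₁ + H ^ 2 • profile (M.defect 2) u₂ +
        H ^ 3 • profile (M.defect 3) u₃ + R)) →
      ‖W (Fin.last s)‖ ≤ C * H ^ 5 := by
  obtain ⟨q₂, q₃, q₄, Q₂, Q₃, Q₄, h₂, h₃, h₄, e₂, e₃, e₄⟩ :=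
    hM.exists_expansion J J₁ P P₁ u₁ u₂ u₃
  obtain ⟨K₀, hK₀, hL₀⟩ := exists_norm_linearRhs_le (fun i => C (M.base.Δc i))
    (fun i j => M.γ i j) J P
  obtain ⟨K₁, hK₁, hL₁⟩ := exists_norm_linearRhs_le (fun i => C (M.base.Δc i) * M.timePoly i)
    (fun i j => C (M.base.c j) * M.γ i j) J₁ P₁
  obtain ⟨D₁, hD₁, hd₁⟩ := exists_norm_profile_le (M.defect 1) u₁
  obtain ⟨D₂, hD₂, hd₂⟩ := exists_norm_profile_le (M.defect 2) u₂
  obtain ⟨D₃, hD₃, hd₃⟩ := exists_norm_profile_le (M.defect 3) u₃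
  -- the profiles are bounded because they have bounded derivatives
  have hbdd : ∀ {q q' : Fin s → ℝ → E} {Q : Fin (s + 1) → E} {B : ℝ}, IsVectorChain q Q q' →
      0 ≤ B → (∀ i, ∀ x ∈ Set.Icc (0 : ℝ) 1, ‖q' i x‖ ≤ B) →
      ∀ i, ∀ x ∈ Set.Icc (0 : ℝ) 1, ‖q i x‖ ≤ s * B := fun h hB hq' => (h.norm_le hB hq').2
  have hb₂ := hbdd h₂ hD₁ hd₁
  have hb₃ := hbdd h₃ (B := D₂ + K₀ * (s * D₁)) (by positivity) fun i x hx =>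
    (norm_add_le _ _).trans (add_le_add (hd₂ i x hx) (hL₀ _ _ hb₂ i x hx))
  set B₂ : ℝ := s * D₁
  set B₃ : ℝ := s * (D₂ + K₀ * B₂)
  have hB₂ : 0 ≤ B₂ := by positivity
  have hB₃ : 0 ≤ B₃ := by positivity
  have hb₄ := hbdd h₄ (B := D₃ + K₀ * B₃ + K₁ * B₂) (by positivity) fun i x hx =>
    (norm_add_le _ _).trans (add_le_add ((norm_add_le _ _).trans
      (add_le_add (hd₃ i x hx) (hL₀ _ _ hb₃ i x hx))) (hL₁ _ _ hb₂ i x hx))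
  set B₄ : ℝ := s * (D₃ + K₀ * B₃ + K₁ * B₂)
  have hB₄ : 0 ≤ B₄ := by positivity
  set L : ℝ := s * (K₀ + K₁ + 2 * K) with hL
  set Q : ℝ := 2 * (s * (D₁ + D₂ + D₃ + K)) with hQ
  set D : ℝ := K * (Q ^ 2 + Q + 1) + (K₀ * B₄ + K₁ * B₃ + K₁ * B₄) with hD
  have hL0 : 0 ≤ L := by positivity
  have hQ0 : 0 ≤ Q := by positivity
  have hD0 : 0 ≤ D := by positivity
  clear_value B₂ B₃ B₄ L Q D
  -- the bound on `H` makes `L H ≤ 1 / 2`, as absorption requires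
  refine ⟨2 * (s * D) + 1, by positivity, min 1 (1 / (2 * L + 1)), by positivity, ?_⟩
  intro H hH hHle ε R W hε hR hW
  have hH1 : H ≤ 1 := hHle.trans (min_le_left _ _)
  have hHL : L * H ≤ 1 / 2 := by
    have := (le_div_iff₀ (by positivity)).1 (hHle.trans (min_le_right _ _))
    have e : H * (2 * L + 1) = 2 * (L * H) + H := by ring
    linarith
  have hpow : ∀ n : ℕ, H ^ (n + 1) ≤ H := fun n => pow_le_of_le_one hH.le hH1 (Nat.succ_ne_zero n)
  -- the error is `O(H ^ 2)`
  have hεH : ∀ i, ∀ x ∈ Set.Icc (0 : ℝ) 1, ‖ε i x‖ ≤ Q * H ^ 2 := by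
    rw [show Q * H ^ 2 = 2 * (s * (D₁ + D₂ + D₃ + K) * H ^ 2) by rw [hQ]; ring]
    refine norm_le_two_mul_of_forall_le_half_add zero_le_one (by positivity) hε ?_
    intro B hB hB1 hBε' i₀ x₀ hx₀
    refine ((hW.norm_le (B := H * ((K₀ + K₁ + 2 * K) * B + (D₁ + D₂ + D₃ + K) * H))
      (by positivity) fun i x hx => ?_).2 i₀ x₀ hx₀).trans ?_
    · simp only [Pi.smul_apply, Pi.add_apply]
      rw [norm_smul, Real.norm_of_nonneg hH.le]
      refine mul_le_mul_of_nonneg_left ?_ hH.le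
      have n0 : ‖M.errorRhs J P ε i x‖ ≤ K₀ * B := hL₀ ε B hBε' i x hx
      have n1 : ‖H • M.errorRhsTime J₁ P₁ ε i x‖ ≤ K₁ * B := by
        rw [norm_smul, Real.norm_of_nonneg hH.le]
        exact (mul_le_of_le_one_left (norm_nonneg _) hH1).trans (hL₁ ε B hBε' i x hx)
      have m1 : ‖H • profile (M.defect 1) u₁ i x‖ ≤ H * D₁ := by
        rw [norm_smul, Real.norm_of_nonneg hH.le]
        exact mul_le_mul_of_nonneg_left (hd₁ i x hx) hH.le
      have m2 : ‖H ^ 2 • profile (M.defect 2) u₂ i x‖ ≤ H * D₂ := by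
        rw [norm_smul, Real.norm_of_nonneg (by positivity)]
        exact mul_le_mul (hpow 1) (hd₂ i x hx) (norm_nonneg _) hH.le
      have m3 : ‖H ^ 3 • profile (M.defect 3) u₃ i x‖ ≤ H * D₃ := by
        rw [norm_smul, Real.norm_of_nonneg (by positivity)]
        exact mul_le_mul (hpow 2) (hd₃ i x hx) (norm_nonneg _) hH.le
      have r : ‖R i x‖ ≤ K * (2 * B + H) := by
        refine (hR B hB hBε' i x hx).trans (mul_le_mul_of_nonneg_left ?_ hK)
        have a1 : B ^ 2 ≤ B := pow_le_of_le_one hB hB1 two_ne_zero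
        have a2 : H ^ 2 * B ≤ B := mul_le_of_le_one_left hB ((hpow 1).trans hH1)
        have a3 : H ^ 4 ≤ H := hpow 3
        linarith
      calc _ ≤ K₀ * B + K₁ * B + H * D₁ + H * D₂ + H * D₃ + K * (2 * B + H) :=
            norm_add_le_of_le (norm_add_le_of_le (norm_add_le_of_le (norm_add_le_of_le
              (norm_add_le_of_le n0 n1) m1) m2) m3) r
        _ = _ := by ring
    · have : L * H * B ≤ 1 / 2 * B := mul_le_mul_of_nonneg_right hHL hB
      rw [hL] at this
      linarith
  -- the error differs from its expansion by `O(H ^ 5)`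
  have hchain := hW.sub (((h₂.const_smul (H ^ 2)).add (h₃.const_smul (H ^ 3))).add
    (h₄.const_smul (H ^ 4)))
  set w : Fin s → ℝ → E := ε - (H ^ 2 • q₂ + H ^ 3 • q₃ + H ^ 4 • q₄) with hw
  -- the remainder is quadratic in the error, hence `O(H ^ 4)`
  have hRH : ∀ i, ∀ x ∈ Set.Icc (0 : ℝ) 1, ‖R i x‖ ≤ K * (Q ^ 2 + Q + 1) * H ^ 4 :=
    fun i x hx => (hR (Q * H ^ 2) (by positivity) hεH i x hx).trans_eq (by ring)
  have hrhs : H • (M.errorRhs J P ε + H • M.errorRhsTime J₁ P₁ ε +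
        H • profile (M.defect 1) u₁ + H ^ 2 • profile (M.defect 2) u₂ +
        H ^ 3 • profile (M.defect 3) u₃ + R) -
      (H ^ 2 • profile (M.defect 1) u₁ + H ^ 3 • (profile (M.defect 2) u₂ + M.errorRhs J P q₂) +
        H ^ 4 • (profile (M.defect 3) u₃ + M.errorRhs J P q₃ + M.errorRhsTime J₁ P₁ q₂)) =
      H • (M.errorRhs J P w + H • M.errorRhsTime J₁ P₁ w + R +
        H ^ 4 • (M.errorRhs J P q₄ + M.errorRhsTime J₁ P₁ q₃ +
          H • M.errorRhsTime J₁ P₁ q₄)) := by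
    simp only [hw, errorRhs, errorRhsTime, linearRhs_sub, linearRhs_add, linearRhs_smul]
    exact expansion_identity (V := Fin s → ℝ → E) H _ _ _ _ _ _ _ _ _ _ _ _
  rw [hrhs] at hchain
  have hwd : ∀ B, 0 ≤ B → (∀ i, ∀ x ∈ Set.Icc (0 : ℝ) 1, ‖w i x‖ ≤ B) →
      (∀ k, ‖(W - (H ^ 2 • Q₂ + H ^ 3 • Q₃ + H ^ 4 • Q₄)) k‖ ≤ B / 2 + s * D * H ^ 5) ∧
        ∀ i, ∀ x ∈ Set.Icc (0 : ℝ) 1, ‖w i x‖ ≤ B / 2 + s * D * H ^ 5 := by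
    intro B hB hBw
    have hle : s * (H * ((K₀ + K₁) * B + D * H ^ 4)) ≤ B / 2 + s * D * H ^ 5 := by
      have h1 : L * H * B ≤ 1 / 2 * B := mul_le_mul_of_nonneg_right hHL hB
      have h2 : 0 ≤ s * (2 * K) * H * B := by positivity
      rw [hL] at h1
      linarith
    have hn := hchain.norm_le (B := H * ((K₀ + K₁) * B + D * H ^ 4)) (by positivity)
      fun i x hx => by
        simp only [Pi.smul_apply, Pi.add_apply]
        rw [norm_smul, Real.norm_of_nonneg hH.le]
        refine mul_le_mul_of_nonneg_left ?_ hH.le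
        have n0 : ‖M.errorRhs J P w i x‖ ≤ K₀ * B := hL₀ w B hBw i x hx
        have n1 : ‖H • M.errorRhsTime J₁ P₁ w i x‖ ≤ K₁ * B := by
          rw [norm_smul, Real.norm_of_nonneg hH.le]
          exact (mul_le_of_le_one_left (norm_nonneg _) hH1).trans (hL₁ w B hBw i x hx)
        have m0 : ‖M.errorRhs J P q₄ i x‖ ≤ K₀ * B₄ := hL₀ _ _ hb₄ i x hx
        have m1 : ‖M.errorRhsTime J₁ P₁ q₃ i x‖ ≤ K₁ * B₃ := hL₁ _ _ hb₃ i x hx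
        have m2 : ‖H • M.errorRhsTime J₁ P₁ q₄ i x‖ ≤ K₁ * B₄ := by
          rw [norm_smul, Real.norm_of_nonneg hH.le]
          exact (mul_le_of_le_one_left (norm_nonneg _) hH1).trans (hL₁ _ _ hb₄ i x hx)
        have m : ‖H ^ 4 • (M.errorRhs J P q₄ i x + M.errorRhsTime J₁ P₁ q₃ i x +
            H • M.errorRhsTime J₁ P₁ q₄ i x)‖ ≤ H ^ 4 * (K₀ * B₄ + K₁ * B₃ + K₁ * B₄) := by
          rw [norm_smul, Real.norm_of_nonneg (by positivity)]
          exact mul_le_mul_of_nonneg_left (norm_add_le_of_le (norm_add_le_of_le m0 m1) m2)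
            (by positivity)
        calc _ ≤ K₀ * B + K₁ * B + K * (Q ^ 2 + Q + 1) * H ^ 4 +
              H ^ 4 * (K₀ * B₄ + K₁ * B₃ + K₁ * B₄) :=
              norm_add_le_of_le (norm_add_le_of_le (norm_add_le_of_le n0 n1) (hRH i x hx)) m
          _ = _ := by rw [hD]; ring
    exact ⟨fun k => (hn.1 k).trans hle, fun i x hx => (hn.2 i x hx).trans hle⟩
  have hw0 : ∀ i, ∀ x ∈ Set.Icc (0 : ℝ) 1, ‖w i x‖ ≤ 1 + (B₂ + B₃ + B₄) := by
    intro i x hx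
    have hs : ∀ (n : ℕ) (z : E) (B : ℝ), ‖z‖ ≤ B → ‖H ^ (n + 1) • z‖ ≤ B := fun n z B hz => by
      rw [norm_smul, Real.norm_of_nonneg (by positivity)]
      exact (mul_le_of_le_one_left (norm_nonneg _) ((hpow n).trans hH1)).trans hz
    rw [hw]
    simp only [Pi.sub_apply, Pi.add_apply, Pi.smul_apply]
    exact norm_sub_le_of_le (hε i x hx) (norm_add_le_of_le (norm_add_le_of_le
      (hs 1 _ _ (hb₂ i x hx)) (hs 2 _ _ (hb₃ i x hx))) (hs 3 _ _ (hb₄ i x hx)))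
  have hwH : ∀ i, ∀ x ∈ Set.Icc (0 : ℝ) 1, ‖w i x‖ ≤ 2 * (s * D * H ^ 5) :=
    norm_le_two_mul_of_forall_le_half_add (by positivity) (by positivity) hw0
      fun B hB _ hBw => (hwd B hB hBw).2
  have hfin := (hwd _ (by positivity) hwH).1 (Fin.last s)
  simp only [Pi.sub_apply, Pi.add_apply, Pi.smul_apply, e₂, e₃, e₄, smul_zero, add_zero,
    sub_zero] at hfin
  have : 0 ≤ H ^ 5 := by positivity
  linarith

end Error

end MRIGARK

/-! ### Error terms and order conditions -/

namespace MRIGARK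

section ErrorTerms

open Polynomial

variable {s : ℕ} {M : MRIGARK s}

/-- Integration by parts: with `G = fastOp g`, the integral of `G + t g` over the step is
`t G` at the end. -/
theorem fastEnd_fastOp_add_fastEnd_timePoly_mul (hs : 0 < s) (g : Fin s → ℝ[X]) :
    M.fastEnd (M.fastOp g) + M.fastEnd (M.timePoly * g) = M.fastEnd g := by
  have h := (chain_eq_of_derivative (r := M.fastRhs (M.fastOp g + M.timePoly * g))
    (q := M.timePoly * M.fastOp g) (Q := fun k => M.cNode k * chainNode (M.fastRhs g) k)
    (by simp [M.cNode_zero hs])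
    (fun i => by
      rw [Pi.mul_apply, eval_mul, timePoly_eval_zero, cNode_castSucc, fastOp,
        LinearMap.comp_apply, eval_zero_chain])
    (fun i => by
      rw [Pi.mul_apply, eval_mul, timePoly_eval_one, cNode_succ, fastOp,
        LinearMap.comp_apply, eval_one_chain])
    (fun i => by
      rw [Pi.mul_apply, derivative_mul, fastOp, LinearMap.comp_apply, derivative_chain,
        fastRhs_apply, fastRhs_apply, Pi.add_apply, Pi.mul_apply]
      simp only [timePoly, derivative_add, derivative_C, derivative_mul, derivative_X, zero_mul,
        zero_add, mul_one, smul_eq_C_mul]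
      ring)).1
  have h' := congrFun h (Fin.last s)
  rw [chainNode_fastRhs_last, cNode_last, chainNode_fastRhs_last, one_mul, map_add] at h'
  exact h'

theorem powError_eq (hs : 0 < s) (m : ℕ) :
    M.powError m = M.slowOp (M.base.c ^ m) - (1 / ((m : ℝ) + 1)) • M.timePoly ^ (m + 1) := by
  rw [powError, defect, map_sub, ← M.fastOp_timePoly_pow hs]
  rfl

theorem stage_powError (hs : 0 < s) (m : ℕ) : stage (M.powError m) =
    M.base.A *ᵥ (M.base.c ^ m) - (1 / ((m : ℝ) + 1)) • M.base.c ^ (m + 1) := by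
  rw [powError_eq hs, map_sub, map_smul, stage_slowOp, stage_timePoly_pow]

theorem fastEnd_powError (hs : 0 < s) (m : ℕ) : M.fastEnd (M.powError m) =
    M.base.Δc ⬝ᵥ (M.frakA *ᵥ (M.base.c ^ m)) - 1 / (((m : ℝ) + 1) * (m + 2)) := by
  rw [powError_eq hs, map_sub, map_smul, fastEnd_slowOp, M.fastEnd_timePoly_pow hs, smul_eq_mul]
  push_cast
  congr 1
  field_simp
  ring

theorem chainNode_defect_last (hs : 0 < s) (m : ℕ) : chainNode (M.defect m) (Fin.last s) =
    M.base.b ⬝ᵥ M.base.c ^ m - 1 / ((m : ℝ) + 1) := by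
  rw [defect, sub_eq_add_neg, ← neg_one_smul ℝ, chainNode_add, chainNode_smul,
    chainNode_slowRhs_last, chainNode_fastRhs_last, M.fastEnd_timePoly_pow hs]
  ring

/-- The thirteen error terms vanish by the order conditions of the base method and the five coupling
conditions, the latter in terms of the integration operators. -/
theorem errorTermsVanish (h : M.base.HasOrder 4)
    (ha : M.fastEnd (M.timePoly * M.slowOp M.base.c) = 1 / 8)
    (hc : M.base.Δc ⬝ᵥ (M.frakA *ᵥ (M.base.c ^ 2)) = 1 / 12)
    (hf : M.base.b ⬝ᵥ stage (M.fastOp (M.slowOp M.base.c)) = 1 / 24)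
    (hh : M.fastEnd (M.fastOp (M.slowOp M.base.c)) = 1 / 24)
    (hi : M.base.Δc ⬝ᵥ (M.frakA *ᵥ (M.base.A *ᵥ M.base.c)) = 1 / 24) : M.ErrorTermsVanish := by
  have hs : 0 < s := h.pos (by norm_num)
  have b1 : M.base.b ⬝ᵥ M.base.c ^ 1 = 1 / 2 := by
    rw [(h.conditions 1 0).1 (by norm_num)]; norm_num
  have b2 : M.base.b ⬝ᵥ M.base.c ^ 2 = 1 / 3 := by
    rw [(h.conditions 2 0).1 (by norm_num)]; norm_num
  have b3 : M.base.b ⬝ᵥ M.base.c ^ 3 = 1 / 4 := by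
    rw [(h.conditions 3 0).1 (by norm_num)]; norm_num
  have b11 : M.base.b ⬝ᵥ (M.base.A *ᵥ (M.base.c ^ 1)) = 1 / 6 := by
    have := (h.conditions 1 0).2.1 (by norm_num)
    rw [pow_zero, one_mul] at this; rw [this]; norm_num
  have b12 : M.base.b ⬝ᵥ (M.base.A *ᵥ (M.base.c ^ 2)) = 1 / 12 := by
    have := (h.conditions 2 0).2.1 (by norm_num)
    rw [pow_zero, one_mul] at this; rw [this]; norm_num
  have b111 : M.base.b ⬝ᵥ (M.base.A *ᵥ (M.base.A *ᵥ (M.base.c ^ 1))) = 1 / 24 := by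
    have := (h.conditions 1 0).2.2 (by norm_num)
    rw [pow_zero, one_mul] at this; rw [this]; norm_num
  have bc1 : M.base.b ⬝ᵥ (M.base.c * M.base.A *ᵥ (M.base.c ^ 1)) = 1 / 8 := by
    have := (h.conditions 1 1).2.1 (by norm_num)
    rw [pow_one M.base.c] at this ⊢; rw [this]; norm_num
  -- the third order coupling condition is the sum of two of the fourth order conditions
  have h3 : M.base.Δc ⬝ᵥ (M.frakA *ᵥ (M.base.c ^ 1)) = 1 / 6 := by
    rw [pow_one, ← fastEnd_slowOp, ← fastEnd_fastOp_add_fastEnd_timePoly_mul hs, ha, hh]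
    norm_num
  have p1 : M.fastOp (M.powError 1) = M.fastOp (M.slowOp M.base.c) -
      (1 / 6 : ℝ) • M.timePoly ^ 3 := by
    rw [powError_eq hs, map_sub, map_smul, M.fastOp_timePoly_pow hs, smul_smul, pow_one]
    norm_num
  have s1 : stage (M.powError 1) =
      M.base.A *ᵥ (M.base.c ^ 1) - (1 / 2 : ℝ) • M.base.c ^ 2 := by
    rw [stage_powError hs]; norm_num
  have s2 : stage (M.powError 2) =
      M.base.A *ᵥ (M.base.c ^ 2) - (1 / 3 : ℝ) • M.base.c ^ 3 := by
    rw [stage_powError hs]; norm_num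
  have t3 : M.fastEnd (M.timePoly ^ 3) = 1 / 4 := by
    rw [M.fastEnd_timePoly_pow hs]; norm_num
  refine ⟨?_, ?_, ?_, ?_, ?_, ?_, ?_, ?_, ?_, ?_, ?_, ?_, ?_⟩
  · rw [chainNode_defect_last hs, b1]; norm_num
  · rw [chainNode_defect_last hs, b2]; norm_num
  · rw [chainNode_defect_last hs, b3]; norm_num
  · rw [fastEnd_powError hs, h3]; norm_num
  · rw [s1, dotProduct_sub, dotProduct_smul, b11, b2]; norm_num
  · rw [fastEnd_powError hs, hc]; norm_num
  · rw [s2, dotProduct_sub, dotProduct_smul, b12, b3]; norm_num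
  · rw [p1, map_sub, map_smul, hh, t3]; norm_num
  · rw [p1, map_sub, map_smul, stage_timePoly_pow, dotProduct_sub, dotProduct_smul, hf, b3]
    norm_num
  · rw [s1, fastEnd_slowOp, mulVec_sub, mulVec_smul, dotProduct_sub, dotProduct_smul, hc, pow_one,
      hi]
    norm_num
  · rw [s1, stage_slowOp, mulVec_sub, mulVec_smul, dotProduct_sub, dotProduct_smul, b111, b12]
    norm_num
  · have e : M.timePoly * M.powError 1 =
        M.timePoly * M.slowOp M.base.c - (1 / 2 : ℝ) • M.timePoly ^ 3 := by
      rw [powError_eq hs, mul_sub, mul_smul_comm, ← pow_succ', pow_one]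
      norm_num
    rw [e, map_sub, map_smul, ha, t3]; norm_num
  · rw [s1, mul_sub, mul_smul_comm, ← pow_succ', dotProduct_sub, dotProduct_smul, bc1, b3]
    norm_num

end ErrorTerms

end MRIGARK

/-! ### Linearization of a smooth system along a solution -/

section Smooth

variable {E : Type*} [NormedAddCommGroup E] [NormedSpace ℝ E]

/-- Solutions of smooth systems are smooth, on a neighbourhood that does not depend on the
smoothness class. -/
theorem exists_contDiffOn_of_hasDerivAt {f : ℝ → E → E}
    (hf : ContDiff ℝ (⊤ : ℕ∞) (Function.uncurry f)) {t₀ : ℝ} {y : ℝ → E}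
    (hy : ∀ᶠ t in 𝓝 t₀, HasDerivAt y (f t (y t)) t) :
    ∃ r > 0, (∀ t ∈ Metric.ball t₀ r, HasDerivAt y (f t (y t)) t) ∧
      ∀ n : ℕ, ContDiffOn ℝ n y (Metric.ball t₀ r) := by
  obtain ⟨r, hr, hball⟩ := Metric.eventually_nhds_iff_ball.1 hy
  refine ⟨r, hr, hball, fun n => ?_⟩
  induction n with
  | zero =>
    exact contDiffOn_zero.2 fun t ht => (hball t ht).continuousAt.continuousWithinAt
  | succ n ih =>
    push_cast
    rw [contDiffOn_succ_iff_deriv_of_isOpen Metric.isOpen_ball]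
    refine ⟨fun t ht => (hball t ht).differentiableAt.differentiableWithinAt, by simp, ?_⟩
    have h : ContDiffOn ℝ n (fun t => Function.uncurry f (t, y t)) (Metric.ball t₀ r) :=
      (hf.of_le (by exact_mod_cast le_top)).comp_contDiffOn (contDiffOn_id.prodMk ih)
    exact h.congr fun t ht => (hball t ht).deriv

theorem exists_taylor_bound {g : ℝ → E} {t₀ r : ℝ} (hr : 0 < r) (n : ℕ)
    (hg : ContDiffOn ℝ (n + 1) g (Metric.ball t₀ r)) :
    ∃ (a : ℕ → E) (K : ℝ), 0 ≤ K ∧ ∀ τ ∈ Set.Icc 0 (r / 2),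
      ‖g (t₀ + τ) - ∑ k ∈ Finset.range (n + 1), τ ^ k • a k‖ ≤ K * τ ^ (n + 1) := by
  have hsub : Set.Icc t₀ (t₀ + r / 2) ⊆ Metric.ball t₀ r := fun t ht => by
    rw [Metric.mem_ball, Real.dist_eq, abs_lt]
    constructor <;> linarith [ht.1, ht.2]
  obtain ⟨K, hK⟩ := exists_taylor_mean_remainder_bound (by linarith) (hg.mono hsub)
  refine ⟨fun k => ((k.factorial : ℝ)⁻¹) • iteratedDerivWithin k g (Set.Icc t₀ (t₀ + r / 2)) t₀,
    max K 0, le_max_right _ _, fun τ hτ => ?_⟩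
  have h := hK (t₀ + τ) ⟨by linarith [hτ.1], by linarith [hτ.2]⟩
  rw [taylor_within_apply, add_sub_cancel_left] at h
  refine le_trans (le_of_eq ?_) (h.trans (mul_le_mul_of_nonneg_right (le_max_left _ _)
    (pow_nonneg hτ.1 _)))
  congr 2
  exact Finset.sum_congr rfl fun k _ => by rw [smul_smul, mul_comm]

/-- Near a smooth curve `y`, a smooth system is its linearization along `y` up to a quadratic
remainder, and the Jacobian along `y` is replaced by the first two terms of its Taylor
expansion. -/
theorem exists_linearization {f : ℝ → E → E} (hf : ContDiff ℝ (⊤ : ℕ∞) (Function.uncurry f))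
    {t₀ r : ℝ} (hr : 0 < r) {y : ℝ → E} (hy : ∀ n : ℕ, ContDiffOn ℝ n y (Metric.ball t₀ r)) :
    ∃ (J J₁ : E →L[ℝ] E) (K δ h : ℝ), 0 ≤ K ∧ 0 < δ ∧ 0 < h ∧
      ∀ τ ∈ Set.Icc 0 h, ∀ z, ‖z - y (t₀ + τ)‖ ≤ δ →
        ‖f (t₀ + τ) z - f (t₀ + τ) (y (t₀ + τ)) - (J + τ • J₁) (z - y (t₀ + τ))‖ ≤
          K * (‖z - y (t₀ + τ)‖ ^ 2 + τ ^ 2 * ‖z - y (t₀ + τ)‖) := by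
  -- the partial derivative of `f` with respect to the state
  set D : ℝ × E → E →L[ℝ] E := fun p =>
    (fderiv ℝ (Function.uncurry f) p).comp (ContinuousLinearMap.inr ℝ ℝ E) with hD
  have hDsmooth : ∀ n : ℕ, ContDiff ℝ n D := fun n => by
    have h : ContDiff ℝ n (fderiv ℝ (Function.uncurry f)) :=
      hf.fderiv_right (by exact_mod_cast le_top)
    exact h.clm_comp contDiff_const
  have hDf : ∀ t z, HasFDerivAt (f t) (D (t, z)) z := fun t z =>
    ((hf.differentiable (by simp)) (t, z)).hasFDerivAt.comp z (hasFDerivAt_prodMk_right t z)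
  have hDy : ContDiffOn ℝ (1 + 1 : ℕ) (fun t => D (t, y t)) (Metric.ball t₀ r) :=
    (hDsmooth 2).comp_contDiffOn (contDiffOn_id.prodMk (hy 2))
  obtain ⟨a, K₁, hK₁, ha⟩ := exists_taylor_bound hr 1 (by exact_mod_cast hDy)
  obtain ⟨K₂, U, hU, hLip⟩ := ((hDsmooth 1).contDiffAt (x := (t₀, y t₀))).exists_lipschitzOnWith
  obtain ⟨ρ, hρ, hρU⟩ := Metric.mem_nhds_iff.1 hU
  have hcont : ContinuousAt y t₀ :=
    ((hy 0).continuousOn.continuousAt (Metric.ball_mem_nhds t₀ hr))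
  obtain ⟨h, hh, hyh⟩ := Metric.continuousAt_iff.1 hcont (ρ / 2) (half_pos hρ)
  refine ⟨a 0, a 1, K₁ + K₂, ρ / 4, min (r / 2) (min (h / 2) (ρ / 2)), by positivity,
    by positivity, by positivity, fun τ hτ z hz => ?_⟩
  have hτ1 := hτ.2.trans (min_le_left _ _)
  have hτ2 := hτ.2.trans ((min_le_right _ _).trans (min_le_left _ _))
  have hτ3 := hτ.2.trans ((min_le_right _ _).trans (min_le_right _ _))
  have habs : |t₀ + τ - t₀| = τ := by rw [add_sub_cancel_left, abs_of_nonneg hτ.1]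
  set t := t₀ + τ with ht
  have hyt : dist (y t) (y t₀) < ρ / 2 := hyh (by rw [Real.dist_eq, habs]; linarith)
  have hmem : ∀ x ∈ Metric.closedBall (y t) ‖z - y t‖, (t, x) ∈ U := fun x hx => by
    refine hρU ?_
    rw [Metric.mem_ball, Prod.dist_eq, max_lt_iff, Real.dist_eq, habs]
    refine ⟨by linarith, ?_⟩
    have := dist_triangle x (y t) (y t₀)
    rw [Metric.mem_closedBall] at hx
    linarith
  have hyU : y t ∈ Metric.closedBall (y t) ‖z - y t‖ := Metric.mem_closedBall_self (norm_nonneg _)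
  have h1 : ‖f t z - f t (y t) - D (t, y t) (z - y t)‖ ≤ K₂ * ‖z - y t‖ * ‖z - y t‖ := by
    refine (convex_closedBall (y t) ‖z - y t‖).norm_image_sub_le_of_norm_hasFDerivWithin_le'
      (f' := fun x => D (t, x)) (fun x _ => (hDf t x).hasFDerivWithinAt) (fun x hx => ?_) hyU
      (by rw [Metric.mem_closedBall, dist_eq_norm])
    have := hLip.dist_le_mul _ (hmem x hx) _ (hmem _ hyU)
    rw [dist_eq_norm, Prod.dist_eq, dist_self, max_eq_right dist_nonneg] at this
    exact this.trans (by gcongr; exact Metric.mem_closedBall.1 hx)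
  have h2 : ‖(D (t, y t) - (a 0 + τ • a 1)) (z - y t)‖ ≤ K₁ * τ ^ 2 * ‖z - y t‖ := by
    refine (ContinuousLinearMap.le_opNorm _ _).trans ?_
    gcongr
    have := ha τ ⟨hτ.1, hτ1⟩
    simpa [Finset.sum_range_succ] using this
  calc ‖f t z - f t (y t) - (a 0 + τ • a 1) (z - y t)‖
      = ‖(f t z - f t (y t) - D (t, y t) (z - y t)) +
          (D (t, y t) - (a 0 + τ • a 1)) (z - y t)‖ := by
        congr 1
        rw [_root_.sub_apply]
        abel
    _ ≤ K₂ * ‖z - y t‖ * ‖z - y t‖ + K₁ * τ ^ 2 * ‖z - y t‖ := norm_add_le_of_le h1 h2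
    _ ≤ _ := by
        have e1 : 0 ≤ (K₂ : ℝ) * (τ ^ 2 * ‖z - y t‖) := by positivity
        have e2 : 0 ≤ K₁ * ‖z - y t‖ ^ 2 := by positivity
        linarith

end Smooth

/-! ### Sufficiency of the order conditions -/

namespace MRIGARK

section Sufficiency

open Polynomial

variable {s : ℕ} {M : MRIGARK s}

theorem defect_zero (hM : M.InternallyConsistent) : M.defect 0 = 0 := by
  rw [defect, pow_zero, pow_zero, M.slowRhs_one hM, sub_self]

theorem Δc_le_one (i : Fin s) : M.base.Δc i ≤ 1 := by
  have h1 := M.cNext_le_one i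
  have h2 := M.c_nonneg i
  rw [RungeKutta.Δc]
  linarith

variable {E : Type*} [NormedAddCommGroup E] [NormedSpace ℝ E]

/-- The defects collect the Taylor terms of the slow tendency at the slow stages and along the
sub-steps. -/
theorem pow_smul_profile_defect (H : ℝ) (m : ℕ) (u : E) (i : Fin s) (x : ℝ) :
    H ^ m • profile (M.defect m) u i x =
      ∑ j, (M.γ i j).eval x • (H * M.base.c j) ^ m • u -
        M.base.Δc i • (H * (M.timePoly i).eval x) ^ m • u := by
  simp only [profile, defect, Pi.sub_apply, slowRhs_apply, fastRhs_apply, eval_sub,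
    eval_finsetSum, eval_smul, Pi.pow_apply, eval_pow, smul_eq_mul, sub_smul, smul_sub, smul_smul,
    Finset.sum_smul, Finset.smul_sum, mul_pow]
  congr 1
  · exact Finset.sum_congr rfl fun j _ => by ring_nf
  · ring_nf

/-- The error of a step satisfies the linearized error equation up to a quadratic remainder, so the
order is four once the error terms vanish. -/
theorem ErrorTermsVanish.hasOrder (h : M.ErrorTermsVanish) (hM : M.InternallyConsistent)
    (hs : 0 < s) : M.HasOrder 4 := by
  intro E _ _ _ fF fS hF hS t₀ y hy
  obtain ⟨r, hr, hyd, hysm⟩ := exists_contDiffOn_of_hasDerivAt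
    (f := fun t z => fF t z + fS t z) (hF.add hS) hy
  obtain ⟨J, J₁, KF, δF, hF', hKF, hδF, hhF, hlinF⟩ := exists_linearization hF hr hysm
  obtain ⟨P, P₁, KS, δS, hS', hKS, hδS, hhS, hlinS⟩ := exists_linearization hS hr hysm
  have hSn : ∀ n : ℕ, ContDiff ℝ n (Function.uncurry fS) := fun n =>
    hS.of_le (by exact_mod_cast le_top)
  have hsol : ContDiffOn ℝ (3 + 1 : ℕ) (fun t => fS t (y t)) (Metric.ball t₀ r) :=
    (hSn 4).comp_contDiffOn (contDiffOn_id.prodMk (hysm 4))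
  obtain ⟨u, KT, hKT, hT⟩ := exists_taylor_bound hr 3 (by exact_mod_cast hsol)
  obtain ⟨G, hG, hγ⟩ := exists_abs_eval_matrix_le M.γ
  obtain ⟨C₀, hC₀, H₀, hH₀, hmain⟩ := h.exists_norm_last_le J J₁ P P₁ (u 1) (u 2) (u 3)
    (K := KF + s * (G * (KS + KT)) + KT) (by positivity)
  set δ : ℝ := min 1 (min δF δS) / 2 with hδ
  have hδ0 : 0 < δ := by positivity
  have hcont : ContinuousAt y t₀ :=
    (hysm 0).continuousOn.continuousAt (Metric.ball_mem_nhds t₀ hr)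
  obtain ⟨h', hh', hyh⟩ := Metric.continuousAt_iff.1 hcont δ hδ0
  refine ⟨C₀, hC₀, δ, hδ0, min H₀ (min (min hF' hS') (min (r / 2) (h' / 2))), by positivity, ?_⟩
  intro H hH hHle Y v hstep hnear
  have hH1 : H ≤ H₀ := hHle.trans (min_le_left _ _)
  have hH2 : H ≤ hF' := hHle.trans ((min_le_right _ _).trans ((min_le_left _ _).trans
    (min_le_left _ _)))
  have hH3 : H ≤ hS' := hHle.trans ((min_le_right _ _).trans ((min_le_left _ _).trans
    (min_le_right _ _)))
  have hH4 : H ≤ r / 2 := hHle.trans ((min_le_right _ _).trans ((min_le_right _ _).trans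
    (min_le_left _ _)))
  have hH5 : H ≤ h' / 2 := hHle.trans ((min_le_right _ _).trans ((min_le_right _ _).trans
    (min_le_right _ _)))
  -- the error in the `i`-th sub-step, and the remainder of its linearized equation
  set ε : Fin s → ℝ → E := fun i x => v i (H * x) - y (t₀ + H * (M.timePoly i).eval x) with hε
  set NF : Fin s → ℝ → E := fun i x =>
    fF (t₀ + H * (M.timePoly i).eval x) (v i (H * x)) -
      fF (t₀ + H * (M.timePoly i).eval x) (y (t₀ + H * (M.timePoly i).eval x)) -
      (J + (H * (M.timePoly i).eval x) • J₁) (ε i x) with hNF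
  set NS : Fin s → E := fun j =>
    fS (t₀ + H * M.base.c j) (Y j.castSucc) - fS (t₀ + H * M.base.c j) (y (t₀ + H * M.base.c j)) -
      (P + (H * M.base.c j) • P₁) (ε j 0) with hNS
  set TS : ℝ → E := fun τ => fS (t₀ + τ) (y (t₀ + τ)) - ∑ k ∈ Finset.range 4, τ ^ k • u k with hTS
  set R : Fin s → ℝ → E := fun i x => M.base.Δc i • NF i x +
    ∑ j, (M.γ i j).eval x • (NS j + TS (H * M.base.c j)) -
      M.base.Δc i • TS (H * (M.timePoly i).eval x) with hR
  have hε0 : ∀ j : Fin s, ε j 0 = Y j.castSucc - y (t₀ + H * M.base.c j) := fun j => by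
    simp only [hε, mul_zero, (hstep.2 j).1, timePoly_eval_zero]
  have hHx : ∀ x ∈ Set.Icc (0 : ℝ) 1, H * x ∈ Set.Icc 0 H := fun x hx =>
    ⟨mul_nonneg hH.le hx.1, mul_le_of_le_one_right hH.le hx.2⟩
  have hHT : ∀ i, ∀ x ∈ Set.Icc (0 : ℝ) 1, H * (M.timePoly i).eval x ∈ Set.Icc 0 H :=
    fun i x hx => hHx _ (M.timePoly_eval_mem_Icc i hx)
  have hHc : ∀ j : Fin s, H * M.base.c j ∈ Set.Icc 0 H := fun j =>
    hHx _ ⟨M.c_nonneg j, M.c_le_one j⟩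
  have hεδ : ∀ i, ∀ x ∈ Set.Icc (0 : ℝ) 1, ‖ε i x‖ ≤ min 1 (min δF δS) := fun i x hx => by
    have h1 := hnear i (H * x) (hHx x hx)
    have h2 : ‖y (t₀ + H * (M.timePoly i).eval x) - y t₀‖ ≤ δ := by
      rw [← dist_eq_norm]
      refine (hyh ?_).le
      rw [Real.dist_eq, add_sub_cancel_left, abs_of_nonneg (hHT i x hx).1]
      linarith [(hHT i x hx).2]
    calc ‖ε i x‖ = ‖(v i (H * x) - y t₀) - (y (t₀ + H * (M.timePoly i).eval x) - y t₀)‖ := by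
          simp only [hε]; congr 1; abel
      _ ≤ δ + δ := norm_sub_le_of_le h1 h2
      _ = _ := by rw [hδ]; ring
  have hzero : (0 : ℝ) ∈ Set.Icc (0 : ℝ) 1 := Set.left_mem_Icc.2 zero_le_one
  have hRbound : ∀ B, 0 ≤ B → (∀ i, ∀ x ∈ Set.Icc (0 : ℝ) 1, ‖ε i x‖ ≤ B) →
      ∀ i, ∀ x ∈ Set.Icc (0 : ℝ) 1, ‖R i x‖ ≤
        (KF + s * (G * (KS + KT)) + KT) * (B ^ 2 + H ^ 2 * B + H ^ 4) := by
    intro B hB hBε i x hx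
    set Q := B ^ 2 + H ^ 2 * B + H ^ 4 with hQ
    have hquad : ∀ (K b τ : ℝ), 0 ≤ K → 0 ≤ b → b ≤ B → τ ∈ Set.Icc 0 H →
        K * (b ^ 2 + τ ^ 2 * b) ≤ K * Q := fun K b τ hK hb hbB hτ => by
      have : 0 ≤ H ^ 4 := by positivity
      have h1 : b ^ 2 ≤ B ^ 2 := by gcongr
      have h2 : τ ^ 2 * b ≤ H ^ 2 * B := by
        gcongr
        · exact hτ.1
        · exact hτ.2
      refine mul_le_mul_of_nonneg_left ?_ hK
      linarith
    have hTb : ∀ τ ∈ Set.Icc 0 H, ‖TS τ‖ ≤ KT * Q := fun τ hτ => by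
      refine (hT τ ⟨hτ.1, hτ.2.trans hH4⟩).trans (mul_le_mul_of_nonneg_left ?_ hKT)
      have h1 : τ ^ 4 ≤ H ^ 4 := pow_le_pow_left₀ hτ.1 hτ.2 4
      have h2 : 0 ≤ B ^ 2 + H ^ 2 * B := by positivity
      calc τ ^ (3 + 1) ≤ H ^ 4 := h1
        _ ≤ Q := by rw [hQ]; linarith
    have hFb : ‖NF i x‖ ≤ KF * Q :=
      (hlinF _ ⟨(hHT i x hx).1, (hHT i x hx).2.trans hH2⟩ _ ((hεδ i x hx).trans
        ((min_le_right _ _).trans (min_le_left _ _)))).trans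
        (hquad KF _ _ hKF (norm_nonneg _) (hBε i x hx) (hHT i x hx))
    have hSb : ∀ j, ‖NS j‖ ≤ KS * Q := fun j => by
      have h1 := hlinS _ ⟨(hHc j).1, (hHc j).2.trans hH3⟩ (Y j.castSucc)
      rw [← hε0] at h1
      exact (h1 ((hεδ j 0 hzero).trans ((min_le_right _ _).trans (min_le_right _ _)))).trans
        (hquad KS _ _ hKS (norm_nonneg _) (hBε j 0 hzero) (hHc j))
    have hΔ : ∀ z : E, ‖M.base.Δc i • z‖ ≤ ‖z‖ := fun z => by
      rw [norm_smul, Real.norm_of_nonneg (M.Δc_nonneg i)]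
      exact mul_le_of_le_one_left (norm_nonneg _) (M.Δc_le_one i)
    have hsum : ‖∑ j, (M.γ i j).eval x • (NS j + TS (H * M.base.c j))‖ ≤
        s * (G * (KS * Q + KT * Q)) := by
      refine (norm_sum_le _ _).trans ((Finset.sum_le_sum (g := fun _ => G * (KS * Q + KT * Q))
        fun j _ => ?_).trans_eq (by simp))
      rw [norm_smul]
      exact mul_le_mul (hγ i j x hx) (norm_add_le_of_le (hSb j) (hTb _ (hHc j))) (norm_nonneg _) hG
    calc ‖R i x‖ ≤ KF * Q + s * (G * (KS * Q + KT * Q)) + KT * Q :=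
          norm_sub_le_of_le (norm_add_le_of_le ((hΔ _).trans hFb) hsum)
            ((hΔ _).trans (hTb _ (hHT i x hx)))
      _ = _ := by ring
  -- the Taylor term of order zero drops out by internal consistency
  have hrhs : ∀ i x, M.base.Δc i • fF (t₀ + H * (M.timePoly i).eval x) (v i (H * x)) +
      ∑ j, (M.γ i j).eval x • fS (t₀ + H * M.base.c j) (Y j.castSucc) -
      M.base.Δc i • (fF (t₀ + H * (M.timePoly i).eval x) (y (t₀ + H * (M.timePoly i).eval x)) +
        fS (t₀ + H * (M.timePoly i).eval x) (y (t₀ + H * (M.timePoly i).eval x))) =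
      M.errorRhs J P ε i x + H • M.errorRhsTime J₁ P₁ ε i x +
        H • profile (M.defect 1) (u 1) i x + H ^ 2 • profile (M.defect 2) (u 2) i x +
        H ^ 3 • profile (M.defect 3) (u 3) i x + R i x := by
    intro i x
    have h0 := M.pow_smul_profile_defect H 0 (u 0) i x
    rw [defect_zero hM] at h0
    simp only [profile, Pi.zero_apply, eval_zero, zero_smul, smul_zero] at h0
    have h1 := M.pow_smul_profile_defect H 1 (u 1) i x
    rw [pow_one] at h1
    rw [h1, pow_smul_profile_defect, pow_smul_profile_defect]
    have hS : ∀ j : Fin s, (M.γ i j).eval x • fS (t₀ + H * M.base.c j) (Y j.castSucc) =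
        (M.γ i j).eval x • (NS j + TS (H * M.base.c j)) +
        (M.γ i j).eval x • P (ε j 0) +
        H • (C (M.base.c j) * M.γ i j).eval x • P₁ (ε j 0) +
        (M.γ i j).eval x • (H * M.base.c j) ^ 0 • u 0 +
        (M.γ i j).eval x • (H * M.base.c j) ^ 1 • u 1 +
        (M.γ i j).eval x • (H * M.base.c j) ^ 2 • u 2 +
        (M.γ i j).eval x • (H * M.base.c j) ^ 3 • u 3 := fun j => by
      simp only [hNS, hTS, Finset.sum_range_succ, Finset.sum_range_zero, eval_mul, eval_C,
        _root_.add_apply, _root_.smul_apply]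
      module
    have hF : M.base.Δc i • fF (t₀ + H * (M.timePoly i).eval x) (v i (H * x)) =
        M.base.Δc i • NF i x + M.base.Δc i • fF (t₀ + H * (M.timePoly i).eval x)
          (y (t₀ + H * (M.timePoly i).eval x)) + M.base.Δc i • J (ε i x) +
          H • (C (M.base.Δc i) * M.timePoly i).eval x • J₁ (ε i x) := by
      simp only [hNF, eval_mul, eval_C, _root_.add_apply,
        _root_.smul_apply]
      module
    have hTT : fS (t₀ + H * (M.timePoly i).eval x) (y (t₀ + H * (M.timePoly i).eval x)) =
        TS (H * (M.timePoly i).eval x) + (H * (M.timePoly i).eval x) ^ 0 • u 0 +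
        (H * (M.timePoly i).eval x) ^ 1 • u 1 + (H * (M.timePoly i).eval x) ^ 2 • u 2 +
        (H * (M.timePoly i).eval x) ^ 3 • u 3 := by
      simp only [hTS, Finset.sum_range_succ, Finset.sum_range_zero]
      module
    rw [Finset.sum_congr rfl fun j _ => hS j, hF, hTT, hR]
    simp only [errorRhs, errorRhsTime, linearRhs, Finset.sum_add_distrib, ← Finset.smul_sum, eval_C]
    rw [sub_eq_zero.1 h0.symm]
    module
  have hchain : IsVectorChain ε (fun k => Y k - y (t₀ + H * M.cNode k))
      (H • (M.errorRhs J P ε + H • M.errorRhsTime J₁ P₁ ε + H • profile (M.defect 1) (u 1) +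
        H ^ 2 • profile (M.defect 2) (u 2) + H ^ 3 • profile (M.defect 3) (u 3) + R)) := by
    refine ⟨?_, fun i => ?_, fun i => ?_, fun i x hx => ?_⟩
    · rw [hstep.1, M.cNode_zero hs, mul_zero, add_zero, sub_self]
    · rw [hε0, cNode_castSucc]
    · simp only [hε, mul_one, timePoly_eval_one, cNode_succ, (hstep.2 i).2.2]
    · have hv := (hstep.2 i).2.1 (H * x) (hHx x hx)
      have hlin : HasDerivWithinAt (fun x : ℝ => H * x) H (Set.Icc 0 1) x := by
        simpa using ((hasDerivAt_id x).const_mul H).hasDerivWithinAt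
      have hv' := hv.scomp x hlin fun x hx => hHx x hx
      have hmem : t₀ + H * (M.timePoly i).eval x ∈ Metric.ball t₀ r := by
        rw [Metric.mem_ball, Real.dist_eq, add_sub_cancel_left, abs_of_nonneg (hHT i x hx).1]
        linarith [(hHT i x hx).2]
      have htime : HasDerivAt (fun x => t₀ + H * (M.timePoly i).eval x) (H * M.base.Δc i) x := by
        have := (((M.timePoly i).hasDerivAt x).const_mul H).const_add t₀
        simpa [timePoly] using this
      have hy' := ((hyd _ hmem).scomp x htime).hasDerivWithinAt (s := Set.Icc 0 1)
      refine (hv'.sub hy').congr_deriv ?_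
      simp only [Pi.smul_apply, Pi.add_apply]
      rw [← hrhs i x, mul_smul, ← smul_sub]
      have e1 : t₀ + M.base.c i * H + M.base.Δc i * (H * x) = t₀ + H * (M.timePoly i).eval x := by
        rw [timePoly_eval]; ring
      have e2 : H * x / H = x := mul_div_cancel_left₀ x hH.ne'
      rw [e1, e2]
      simp only [mul_comm _ H]
  have hfin := hmain H hH hH1 ε R _ (fun i x hx => (hεδ i x hx).trans (min_le_left _ _)) hRbound
    hchain
  rw [cNode_last, mul_one] at hfin
  exact hfin

end Sufficiency

end MRIGARK

theorem mainTheorem1 (s : ℕ) (M : MRIGARK s) (hM : M.InternallyConsistent) :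
    (M.HasOrder 4 ↔
      M.base.HasOrder 4 ∧
      -- (a)
      1 / 2 * (M.z ⬝ᵥ (M.base.A *ᵥ M.base.c)) +
        ∑ k ∈ Finset.range (maxDegree M.γ + 1),
          (M.base.Δc * (zetaCoeff k • M.base.c + omegaCoeff k • M.base.Δc)) ⬝ᵥ
            (gammaCoeff M.γ k *ᵥ M.base.c) = 1 / 8 ∧
      -- (c)
      M.base.Δc ⬝ᵥ (M.frakA *ᵥ (M.base.c ^ 2)) = 1 / 12 ∧
      -- (f)
      M.d ⬝ᵥ (M.frakA *ᵥ M.base.c) = 1 / 24 ∧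
      -- (h)
      (M.base.Δc ^ 2) ⬝ᵥ (((1 / 2 : ℝ) • M.base.A + gammaSum M.γ xiCoeff) *ᵥ M.base.c) +
        M.t ⬝ᵥ (M.frakA *ᵥ M.base.c) = 1 / 24 ∧
      -- (i)
      M.base.Δc ⬝ᵥ (M.frakA *ᵥ (M.base.A *ᵥ M.base.c)) = 1 / 24) ∧
    -- the other five MR-GARK coupling conditions, for any sufficiently accurate fast method
    (M.base.HasOrder 4 → ∀ (σ : ℕ) (F : RungeKutta σ), F.HasOrder (maxDegree M.γ + 3) →
      -- (b)
      M.base.b ⬝ᵥ (M.base.c * (M.Asf F *ᵥ M.cf F)) = 1 / 8 ∧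
      -- (d)
      M.base.b ⬝ᵥ (M.Asf F *ᵥ (M.cf F ^ 2)) = 1 / 12 ∧
      -- (e)
      M.base.b ⬝ᵥ (M.base.A *ᵥ (M.Asf F *ᵥ M.cf F)) = 1 / 24 ∧
      -- (g)
      M.base.b ⬝ᵥ (M.Asf F *ᵥ (M.Aff F *ᵥ M.cf F)) = 1 / 24 ∧
      -- (j), which is the same as (c)
      (M.bf F ⬝ᵥ (M.Afs F *ᵥ (M.Asf F *ᵥ M.cf F)) = 1 / 24 ↔
        M.base.Δc ⬝ᵥ (M.frakA *ᵥ (M.base.c ^ 2)) = 1 / 12)) := by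
  refine ⟨⟨fun h => ?_, fun h => ?_⟩, fun h σ F hF => MRIGARK.discretized_coupling h hF⟩
  · have hb := h.base.sum_b (by norm_num)
    exact ⟨h.base, h.coupling hb⟩
  · obtain ⟨h, ha, hc, hf, hh, hi⟩ := h
    have hb := h.sum_b (by norm_num)
    refine (MRIGARK.errorTermsVanish h ?_ hc ?_ ?_ hi).hasOrder hM (h.pos (by norm_num))
    · rw [MRIGARK.fastEnd_timePoly_mul_slowOp, ha]
    · rw [MRIGARK.dotProduct_stage_fastOp_slowOp M hb, hf]
    · rw [MRIGARK.fastEnd_fastOp_slowOp, hh]
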